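/- **Setting.** Let $d,K,m\in\mathbb N$ and let $M_1,\dots,M_K\subseteq\{1,\dots,d\}$ be pairwise distinct super arms with $|M_i|=m$ for all $i$. An instance is a probability distribution $\nu$ on $[0,1]^d$ with mean vector $\mu$; write $f(M,x)=\sum_{e\in M}x(e)$. In round $t$ a super arm $M(t)$ is played, a vector $w_t\sim\nu$ is drawn independently of the past and of $M(t)$, and the learner observes $f(M(t),w_t)$ (full-bandit feedback) or $(w_t(e))_{e\in M(t)}$ (semi-bandit feedback). Fix $0<\delta<\tfrac12$, and let $\mathcal V_0$ be the set of instances $\nu$ for which every super arm $M_i$ satisfies $\Delta_{M_i}:=\max_k f(M_k,\mu)-f(M_i,\mu)\in\{0\}\cup[\delta,\infty)$. A pair $(\pi,\hat\Delta_M)$ consists, for every horizon $n$, of a policy $\pi$ (a conditional law of the next super arm given the observed history) and of estimators $\hat\Delta_{M,n}^{(i,j)}$, which are measurable functions of the observed history of $n$ rounds, of the gaps $\Delta_M^{(i,j)}=f(M_i,\mu)-f(M_j,\mu)$. For $\nu\in\mathcal V_0$ put $$\mathcal R_\nu(n,\pi)=\sum_{t=1}^n\Big(\max_k f(M_k,\mu)-\mathbb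 E\,f(M(t),w_t)\Big),\qquad \mathcal E_\nu(n,\hat\Delta_M)=\max_{i<j}\mathbb E\big|\Delta_M^{(i,j)}-\hat\Delta_{M,n}^{(i,j)}\big|$$ (the maximum is $0$ if $K\le 1$). The pair is admissible if the estimators are integrable and $\mathbb E|\Delta_M^{(i,j)}-\hat\Delta_{M,n}^{(i,j)}|$ is bounded uniformly in $n$, in $i<j$ and in $\nu\in\mathcal V_0$. For nonnegative functions $g,h$ of $n$ write $g\preceq h$ if there are $C$ and $a\in\mathbb N$ with $g(n)\le C(\log n)^a h(n)$ for all large $n$; such an inequality is strict if $h\preceq g$ fails. A pair $(\pi',\hat\Delta'_M)$ Pareto dominates $(\pi,\hat\Delta_M)$ if for every sequence $(\nu'_n)$ in $\mathcal V_0$ there is a sequence $(\nu_n)$ in $\mathcal V_0$ such that $$\mathcal R_{\nu'_n}(n,\pi')\preceq\mathcal R_{\nu_n}(n,\pi)\quad\text{and}\quad\mathcal E_{\nu'_n}(n,\hat\Delta'_M)\preceq\mathcal E_{\nu_n}(n,\hat\Delta_M),$$ with at least one of the two strict. (That is, every objective point attained by the first pair lies strictly below one attained by the second.) An admissible pair is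 Pareto optimal if no admissible pair Pareto dominates it. **Theorem.** Under either feedback model, an admissible pair $(\pi,\hat\Delta_M)$ is Pareto optimal if and only if $$\sup_{\nu\in\mathcal V_0}\Big[\Big(\max_{i<j}\mathbb E\big|\Delta_M^{(i,j)}-\hat\Delta_{M,n}^{(i,j)}\big|\Big)\sqrt{\mathcal R_\nu(n,\pi)}\Big]=\widetilde{\mathcal O}(1)\qquad(n\to\infty),$$ i.e. if and only if there are $C$ and $a\in\mathbb N$ such that the left-hand side is at most $C(\log n)^a$ for all large $n$. -/

import Mathlib

open MeasureTheory ProbabilityTheory Filter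

noncomputable section

namespace CMAB

/-- A realisation of the reward vector, a point of `[0,1]^d`. -/
abbrev RewardVec (d : ℕ) : Type := Fin d → unitInterval

/-- The total weight `f(G, x) = ∑_{e ∈ G} x(e)` of a set `G` of base arms. -/
def weight {d : ℕ} (G : Finset (Fin d)) (x : Fin d → ℝ) : ℝ := ∑ e ∈ G, x e

/-- The total reward of a set `G` of base arms under the realised reward vector `w`. -/
def reward {d : ℕ} (G : Finset (Fin d)) (w : RewardVec d) : ℝ := weight G (fun e => (w e : ℝ))

/-- The two feedback regimes. -/
inductive Feedback : Type
  | fullBandit : Feedback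
  | semiBandit : Feedback

/-- What is observed in one round: the aggregate reward, or the rewards of the chosen base arms. -/
def Feedback.Obs : Feedback → ℕ → Type
  | .fullBandit, _ => ℝ
  | .semiBandit, d => Fin d → ℝ

instance Feedback.instMeasurableSpaceObs (fb : Feedback) (d : ℕ) : MeasurableSpace (fb.Obs d) :=
  match fb with
  | .fullBandit => inferInstanceAs (MeasurableSpace ℝ)
  | .semiBandit => inferInstanceAs (MeasurableSpace (Fin d → ℝ))

/-- The observation made when the set `G` is played and the reward vector is `w`. Under
semi-bandit feedback the coordinates outside `G` are masked by `0`; since the played super arm is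
part of the history, this carries exactly the information `(w e)_{e ∈ G}`. -/
def Feedback.observe (fb : Feedback) {d : ℕ} (G : Finset (Fin d)) (w : RewardVec d) : fb.Obs d :=
  match fb with
  | .fullBandit => reward G w
  | .semiBandit => fun e => if e ∈ G then (w e : ℝ) else 0

theorem Feedback.measurable_observe (fb : Feedback) {d : ℕ} (G : Finset (Fin d)) :
    Measurable (fb.observe G) := by
  cases fb with
  | fullBandit =>
    show Measurable (fun w : RewardVec d => ∑ e ∈ G, (w e : ℝ))
    fun_prop
  | semiBandit =>
    show Measurable (fun (w : RewardVec d) (e : Fin d) => if e ∈ G then (w e : ℝ) else 0)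
    refine measurable_pi_lambda _ fun e => ?_
    by_cases h : e ∈ G
    · simp only [h, if_true]; fun_prop
    · simp only [h, if_false]; fun_prop

/-- Complete trajectory of `t` rounds: played super arms (by index) and realised reward vectors. -/
abbrev Traj (K d t : ℕ) : Type := Fin t → Fin K × RewardVec d

/-- Observed history of `t` rounds: played super arms (by index) and observations. -/
abbrev Hist (fb : Feedback) (K d t : ℕ) : Type := Fin t → Fin K × fb.Obs d

/-- The part of a trajectory that the decision maker sees. -/
def observed (fb : Feedback) {K d : ℕ} (S : Fin K → Finset (Fin d)) (t : ℕ)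
    (h : Traj K d t) : Hist fb K d t :=
  fun s => ((h s).1, fb.observe (S (h s).1) (h s).2)

theorem measurable_observed (fb : Feedback) {K d : ℕ} (S : Fin K → Finset (Fin d)) (t : ℕ) :
    Measurable (observed fb S t) := by
  have key : Measurable
      (fun p : Fin K × RewardVec d => (p.1, fb.observe (S p.1) p.2)) :=
    measurable_from_prod_countable_right fun i =>
      measurable_const.prodMk (fb.measurable_observe (S i))
  exact measurable_pi_lambda _ fun s => key.comp (measurable_pi_apply s)

/-- A (possibly randomised) policy: the law of the super arm of round `t + 1` given the observed
history of the first `t` rounds. -/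
structure Policy (fb : Feedback) (K d : ℕ) where
  kernel : (t : ℕ) → Kernel (Hist fb K d t) (Fin K)
  markov : ∀ t, IsMarkovKernel (kernel t)

/-- The law of the first `t` rounds when the super arms are chosen by `π` and the reward vectors
are drawn from `ν`, independently of the past and of the super arm chosen in the same round. -/
def trajLaw {fb : Feedback} {K d : ℕ} (S : Fin K → Finset (Fin d)) (π : Policy fb K d)
    (ν : ProbabilityMeasure (RewardVec d)) : (t : ℕ) → Measure (Traj K d t)
  | 0 => Measure.dirac (fun s => Fin.elim0 s)
  | t + 1 =>
    ((trajLaw S π ν t) ⊗ₘ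
      (((π.kernel t).comap (observed fb S t) (measurable_observed fb S t)) ×ₖ
        Kernel.const (Traj K d t) (ν : Measure (RewardVec d)))).map
      (fun p => Fin.snoc (α := fun _ => Fin K × RewardVec d) p.1 p.2)

/-- The mean reward vector `μ` of the instance `ν`. -/
def mean {d : ℕ} (ν : ProbabilityMeasure (RewardVec d)) (e : Fin d) : ℝ :=
  ∫ w, (w e : ℝ) ∂(ν : Measure (RewardVec d))

/-- The mean reward `f(M_i, μ)` of the `i`-th super arm. -/
def armValue {K d : ℕ} (S : Fin K → Finset (Fin d)) (ν : ProbabilityMeasure (RewardVec d))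
    (i : Fin K) : ℝ := weight (S i) (mean ν)

/-- The mean reward of an optimal super arm. -/
def optValue {K d : ℕ} (S : Fin K → Finset (Fin d)) (ν : ProbabilityMeasure (RewardVec d)) : ℝ :=
  ⨆ i, armValue S ν i

/-- The gap `f(M_i, μ) - f(M_j, μ)` between two super arms. -/
def armGap {K d : ℕ} (S : Fin K → Finset (Fin d)) (ν : ProbabilityMeasure (RewardVec d))
    (i j : Fin K) : ℝ := armValue S ν i - armValue S ν j

/-- The instances whose suboptimal super arms are suboptimal by at least `δ`. -/
def instances {K d : ℕ} (S : Fin K → Finset (Fin d)) (δ : ℝ) :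
    Set (ProbabilityMeasure (RewardVec d)) :=
  {ν | ∀ i, armValue S ν i = optValue S ν ∨ δ ≤ optValue S ν - armValue S ν i}

/-- The cumulative regret of `π` over `n` rounds. -/
def regret {fb : Feedback} {K d : ℕ} (S : Fin K → Finset (Fin d)) (π : Policy fb K d)
    (ν : ProbabilityMeasure (RewardVec d)) (n : ℕ) : ℝ :=
  ∑ t : Fin n, (optValue S ν - ∫ h, reward (S (h t).1) (h t).2 ∂(trajLaw S π ν n))

/-- A policy together with an estimator of the super-arm gaps, for every time horizon `n`. Both may
depend on `n`; `est n i j` maps the observed history of `n` rounds to the estimate of the gap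
between super arms `i` and `j`. -/
structure DesignPair (fb : Feedback) (K d : ℕ) where
  policy : ℕ → Policy fb K d
  est : (n : ℕ) → Fin K → Fin K → Hist fb K d n → ℝ
  measurable_est : ∀ n i j, Measurable (est n i j)

namespace DesignPair

variable {fb : Feedback} {K d : ℕ}

/-- The law of the trajectory for the time horizon `n`. -/
def law (P : DesignPair fb K d) (S : Fin K → Finset (Fin d))
    (ν : ProbabilityMeasure (RewardVec d)) (n : ℕ) : Measure (Traj K d n) :=
  trajLaw S (P.policy n) ν n

/-- The regret `R_ν(n, π)`. -/
def regret (P : DesignPair fb K d) (S : Fin K → Finset (Fin d))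
    (ν : ProbabilityMeasure (RewardVec d)) (n : ℕ) : ℝ :=
  CMAB.regret S (P.policy n) ν n

/-- The estimation error `E |Δ^(i,j) - Δ̂_n^(i,j)|`. -/
def gapError (P : DesignPair fb K d) (S : Fin K → Finset (Fin d))
    (ν : ProbabilityMeasure (RewardVec d)) (n : ℕ) (i j : Fin K) : ℝ :=
  ∫ h, |armGap S ν i j - P.est n i j (observed fb S n h)| ∂(P.law S ν n)

/-- The largest estimation error over the pairs `i < j` (zero if there is no such pair). -/
def maxError (P : DesignPair fb K d) (S : Fin K → Finset (Fin d))
    (ν : ProbabilityMeasure (RewardVec d)) (n : ℕ) : ℝ :=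
  ⨆ p : {p : Fin K × Fin K // p.1 < p.2}, P.gapError S ν n p.1.1 p.1.2

/-- Admissibility over the class of instances `V`: the estimation errors exist and are bounded
uniformly in the instance and the horizon. -/
def IsAdmissible (P : DesignPair fb K d) (S : Fin K → Finset (Fin d))
    (V : Set (ProbabilityMeasure (RewardVec d))) : Prop :=
  ∃ B : ℝ, ∀ n, ∀ ν ∈ V, ∀ i j : Fin K, i < j →
    Integrable (fun h => P.est n i j (observed fb S n h)) (P.law S ν n) ∧
      P.gapError S ν n i j ≤ B

end DesignPair

/-- `f ⪯ g`: `f` is at most of the order of `g` up to constant and polylogarithmic factors. -/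
def LogLE (f g : ℕ → ℝ) : Prop :=
  ∃ (C : ℝ) (a : ℕ), ∀ᶠ n : ℕ in atTop, f n ≤ C * Real.log n ^ a * g n

/-- `P'` Pareto dominates `P` in the worst case over `V`: every point
`(regret, largest error)` that `P'` attains on `V` is matched by a point that `P` attains on `V` and
that is at least as bad in both coordinates and strictly worse in one of them, in the order `⪯`. As
orders refer to `n → ∞`, the instances may vary with the horizon. -/
def ParetoDominates {fb : Feedback} {K d : ℕ} (S : Fin K → Finset (Fin d))
    (V : Set (ProbabilityMeasure (RewardVec d))) (P' P : DesignPair fb K d) : Prop :=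
  ∀ ν' : ℕ → ProbabilityMeasure (RewardVec d), (∀ n, ν' n ∈ V) →
    ∃ ν : ℕ → ProbabilityMeasure (RewardVec d), (∀ n, ν n ∈ V) ∧
      LogLE (fun n => P'.regret S (ν' n) n) (fun n => P.regret S (ν n) n) ∧
      LogLE (fun n => P'.maxError S (ν' n) n) (fun n => P.maxError S (ν n) n) ∧
      (¬ LogLE (fun n => P.regret S (ν n) n) (fun n => P'.regret S (ν' n) n) ∨
        ¬ LogLE (fun n => P.maxError S (ν n) n) (fun n => P'.maxError S (ν' n) n))

/-- No admissible pair Pareto dominates `P`. -/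
def IsParetoOptimal {fb : Feedback} {K d : ℕ} (S : Fin K → Finset (Fin d))
    (V : Set (ProbabilityMeasure (RewardVec d))) (P : DesignPair fb K d) : Prop :=
  ¬ ∃ P' : DesignPair fb K d, P'.IsAdmissible S V ∧ ParetoDominates S V P' P

/-- `sup_{ν ∈ V} [(max_{i<j} error) * √regret]` is `Õ(1)` as the horizon `n` tends to infinity. -/
def WorstCaseProductIsTildeOOne {fb : Feedback} {K d : ℕ} (S : Fin K → Finset (Fin d))
    (V : Set (ProbabilityMeasure (RewardVec d))) (P : DesignPair fb K d) : Prop :=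
  ∃ (C : ℝ) (a : ℕ), ∀ᶠ n : ℕ in atTop, ∀ ν ∈ V,
    P.maxError S ν n * √(P.regret S ν n) ≤ C * Real.log n ^ a

end CMAB

end

/-!
The theorem rests on two facts about the trade-off between regret and estimation error.

*No pair beats the rate `error * √regret = 1`* (`exists_le_maxError_mul_sqrt_regret`). Fix two super
arms `i ≠ j` and consider the instances `hardLaw S i j p` in which the base arms of `S i` pay `1 / 2`
and those of `S j \ S i` pay a common Bernoulli variable of mean `p`. For `p ≤ 1 / 2 - δ` the arm `i`
is optimal, and only the suboptimal plays, each of which costs at least `δ`, carry information on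
`p`; but the gap between `i` and `j` depends on `p`. Choose `p` with nearly minimal regret `R` and
compare it with a parameter at distance of order `1 / √R`: the divergence of the two laws of the
history is at most the number of informative plays times the squared distance, so it is bounded, and
an error of order `1 / √R` is unavoidable at one of the two, where the regret is at least `R / 2`
(`abs_sub_mul_le_gapError_add`). If the regret is so small at some `p` that `i` is the only arm
played with probability at least `1 / 2`, then the same happens at all `p ≥ 1 / 2 + δ`, where it
makes the regret linear and the error constant. Everything is derived from one inequality between
histories under different instances, `lintegral_mul_likelihood_le`, which asks only for domination
of the observations of a single round and thus treats both kinds of feedback at once.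

*Every trade-off on that curve is attained* (`etc_tradeoff`). Explore-then-commit with
`N ≥ C * log n` rounds per arm has regret `O(N)`, because by Hoeffding's inequality and the gap
`δ` it commits to a suboptimal arm with probability at most `O(1 / n)`, and error `O(1 / √N)`.

Suppose that `error * √regret` is `Õ(1)` for `P`, and that `P'` dominates `P`. Along instances for
which `error * √regret` of `P'` is bounded below, the two comparisons between `P'` and `P` force
equality up to polylogarithmic factors in both coordinates. Conversely, if the product is not `Õ(1)`
for `P`, let `P'` agree with `P` at the horizons where the supremum of the product is at most of
order `log n`, and be explore-then-commit, with regret of the order of that of `P` at a worst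
instance, at the others. It dominates `P`: at the latter horizons it is compared with the worst
instance, where both coordinates of `P` are at least of the order of those of `P'`, and if the orders
agreed in both, the product would be `Õ(1)` after all.
-/

noncomputable section

namespace CMAB

/-! ### The law of a trajectory -/

theorem measurable_snoc {α : Type*} [MeasurableSpace α] (t : ℕ) :
    Measurable (fun p : (Fin t → α) × α => Fin.snoc (α := fun _ => α) p.1 p.2) := by
  refine measurable_pi_lambda _ fun i => ?_
  induction i using Fin.lastCases with
  | last => simpa using measurable_snd
  | cast i =>
    simp only [Fin.snoc_castSucc]
    fun_prop

theorem measurable_arm {K d n : ℕ} (t : Fin n) : Measurable fun h : Traj K d n => (h t).1 :=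
  measurable_fst.comp (measurable_pi_apply t)

section TrajLaw

variable {fb : Feedback} {K d : ℕ} (S : Fin K → Finset (Fin d)) (π : Policy fb K d)
  (ν : ProbabilityMeasure (RewardVec d))

theorem observed_snoc (t : ℕ) (h : Traj K d t) (p : Fin K × RewardVec d) :
    observed fb S (t + 1) (Fin.snoc (α := fun _ => Fin K × RewardVec d) h p) =
      Fin.snoc (α := fun _ => Fin K × fb.Obs d) (observed fb S t h)
        (p.1, fb.observe (S p.1) p.2) := by
  funext i
  induction i using Fin.lastCases with
  | last => simp [observed]
  | cast i => simp [observed]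

instance isProbabilityMeasure_trajLaw (t : ℕ) : IsProbabilityMeasure (trajLaw S π ν t) := by
  induction t with
  | zero => rw [trajLaw]; infer_instance
  | succ t ih =>
    have := π.markov t
    rw [trajLaw]
    exact Measure.isProbabilityMeasure_map (measurable_snoc t).aemeasurable

/-- One more round, integrated out: first over the past, then over the arm, then over the
rewards. -/
theorem lintegral_trajLaw_succ (t : ℕ) {F : Traj K d (t + 1) → ENNReal} (hF : Measurable F) :
    ∫⁻ h, F h ∂trajLaw S π ν (t + 1) =
      ∫⁻ h, ∫⁻ a, ∫⁻ w, F (Fin.snoc (α := fun _ => Fin K × RewardVec d) h (a, w))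
        ∂(ν : Measure (RewardVec d)) ∂π.kernel t (observed fb S t h) ∂trajLaw S π ν t := by
  have := π.markov t
  have hm : Measurable fun p : Traj K d t × (Fin K × RewardVec d) =>
      F (Fin.snoc (α := fun _ => Fin K × RewardVec d) p.1 p.2) := hF.comp (measurable_snoc t)
  rw [trajLaw, lintegral_map hF (measurable_snoc t), Measure.lintegral_compProd hm]
  refine lintegral_congr fun h => ?_
  refine (Kernel.lintegral_prod _ _ h (g := fun p => F (Fin.snoc
    (α := fun _ => Fin K × RewardVec d) h p)) (hm.comp measurable_prodMk_left)).trans ?_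
  simp [Kernel.comap_apply]

theorem lintegral_trajLaw_init (t : ℕ) {F : Traj K d t → ENNReal} (hF : Measurable F) :
    ∫⁻ h, F (fun s => h s.castSucc) ∂trajLaw S π ν (t + 1) = ∫⁻ h, F h ∂trajLaw S π ν t := by
  have := π.markov t
  rw [lintegral_trajLaw_succ S π ν t (F := fun h => F fun s => h s.castSucc)
    (hF.comp (by fun_prop))]
  simp

/-- The rewards of a round are independent of the arm played in it. -/
theorem lintegral_trajLaw_round (n : ℕ) (t : Fin n) {φ : Fin K × RewardVec d → ENNReal}
    (hφ : Measurable φ) :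
    ∫⁻ h, φ (h t) ∂trajLaw S π ν n =
      ∫⁻ h, ∫⁻ w, φ ((h t).1, w) ∂(ν : Measure (RewardVec d)) ∂trajLaw S π ν n := by
  have hψ : Measurable fun a : Fin K => ∫⁻ w, φ (a, w) ∂(ν : Measure (RewardVec d)) :=
    measurable_of_countable _
  induction n with
  | zero => exact t.elim0
  | succ n ih =>
    have := π.markov n
    induction t using Fin.lastCases with
    | last =>
      rw [lintegral_trajLaw_succ S π ν n (F := fun h => φ (h (Fin.last n)))
          (hφ.comp (measurable_pi_apply _)),
        lintegral_trajLaw_succ S π ν n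
          (F := fun h => ∫⁻ w, φ ((h (Fin.last n)).1, w) ∂(ν : Measure (RewardVec d)))
          (hψ.comp (measurable_arm _))]
      simp
    | cast t =>
      have h1 := lintegral_trajLaw_init S π ν n (F := fun h => φ (h t))
        (hφ.comp (measurable_pi_apply _))
      have h2 := lintegral_trajLaw_init S π ν n
        (F := fun h => ∫⁻ w, φ ((h t).1, w) ∂(ν : Measure (RewardVec d)))
        (hψ.comp (measurable_fst.comp (measurable_pi_apply t)))
      rw [h1, h2, ih]

theorem map_trajLaw_round (n : ℕ) (t : Fin n) :
    (trajLaw S π ν n).map (fun h => h t) =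
      ((trajLaw S π ν n).map (fun h => (h t).1)).prod (ν : Measure (RewardVec d)) := by
  have : IsProbabilityMeasure ((trajLaw S π ν n).map (fun h => (h t).1)) :=
    Measure.isProbabilityMeasure_map (measurable_arm t).aemeasurable
  refine Measure.ext_of_lintegral _ fun φ hφ => ?_
  rw [lintegral_map hφ (by fun_prop), lintegral_prod _ hφ.aemeasurable,
    lintegral_map (measurable_of_countable _) (measurable_arm t),
    lintegral_trajLaw_round S π ν n t hφ]

/-- Bochner version of `lintegral_trajLaw_round`, for bounded functions. -/
theorem integral_trajLaw_round (n : ℕ) (t : Fin n) {φ : Fin K → RewardVec d → ℝ}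
    (hφ : ∀ a, Measurable (φ a)) {B : ℝ} (hB : ∀ a w, |φ a w| ≤ B) :
    ∫ h, φ (h t).1 (h t).2 ∂trajLaw S π ν n =
      ∫ h, (∫ w, φ (h t).1 w ∂(ν : Measure (RewardVec d))) ∂trajLaw S π ν n := by
  have : IsProbabilityMeasure ((trajLaw S π ν n).map (fun h => (h t).1)) :=
    Measure.isProbabilityMeasure_map (measurable_arm t).aemeasurable
  have hm : Measurable fun p : Fin K × RewardVec d => φ p.1 p.2 :=
    measurable_from_prod_countable_right hφ
  have h1 := integral_map (μ := trajLaw S π ν n) (φ := fun h => h t)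
    (measurable_pi_apply t).aemeasurable
    (f := fun p : Fin K × RewardVec d => φ p.1 p.2) hm.aestronglyMeasurable
  rw [← h1, map_trajLaw_round, integral_prod _
    (Integrable.of_bound hm.aestronglyMeasurable B (.of_forall fun p => hB _ _)),
    integral_map (measurable_arm t).aemeasurable (measurable_of_countable _).aestronglyMeasurable]

theorem lintegral_trajLaw_prod (n : ℕ) {g : Fin n → RewardVec d → ENNReal}
    (hg : ∀ t, Measurable (g t)) :
    ∫⁻ h, ∏ t, g t (h t).2 ∂trajLaw S π ν n =
      ∏ t, ∫⁻ w, g t w ∂(ν : Measure (RewardVec d)) := by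
  induction n with
  | zero => simp
  | succ n ih =>
    have := π.markov n
    have hm : Measurable fun h : Traj K d (n + 1) => ∏ t, g t (h t).2 :=
      Finset.measurable_fun_prod _ fun t _ =>
        (hg t).comp (measurable_snd.comp (measurable_pi_apply t))
    have hm' : Measurable fun h : Traj K d n => ∏ t, g t.castSucc (h t).2 :=
      Finset.measurable_fun_prod _ fun t _ =>
        (hg t.castSucc).comp (measurable_snd.comp (measurable_pi_apply t))
    rw [lintegral_trajLaw_succ S π ν n hm]
    simp only [Fin.prod_univ_castSucc, Fin.snoc_castSucc, Fin.snoc_last]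
    simp only [lintegral_const_mul _ (hg _), lintegral_const, measure_univ, mul_one]
    rw [lintegral_mul_const _ hm', ih fun t => hg t.castSucc]

/-- Whatever the policy, the reward vectors of the rounds are i.i.d. with law `ν`. -/
theorem map_trajLaw_rewards (n : ℕ) :
    (trajLaw S π ν n).map (fun h t => (h t).2) =
      Measure.pi fun _ : Fin n => (ν : Measure (RewardVec d)) := by
  refine (Measure.pi_eq fun s hs => ?_).symm
  have h1 := lintegral_trajLaw_prod S π ν n (g := fun t => (s t).indicator 1)
    fun t => measurable_one.indicator (hs t)
  simp only [lintegral_indicator_one (hs _)] at h1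
  rw [← h1, Measure.map_apply (by fun_prop) (MeasurableSet.univ_pi hs), ← lintegral_indicator_one
    ((MeasurableSet.univ_pi hs).preimage (by fun_prop))]
  refine lintegral_congr fun h => ?_
  by_cases H : ∀ t, (h t).2 ∈ s t
  · simp [Set.indicator, H]
  · have H' := H
    push Not at H'
    obtain ⟨t, ht⟩ := H'
    rw [Finset.prod_eq_zero (Finset.mem_univ t) (by simp [ht])]
    simp [Set.indicator, H]

/-! ### Change of measure -/

/-- If under `ν` each observation, weighted by `r`, is dominated by the observation under `ν'`,
then the same holds for whole histories, weighted by the product of the `r`'s: the policy sees only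
the observations, so its own randomisation cancels. -/
theorem lintegral_mul_likelihood_le (ν' : ProbabilityMeasure (RewardVec d))
    {r : Fin K → RewardVec d → ENNReal} (hr : ∀ a, Measurable (r a))
    (hle : ∀ a, ∀ F : fb.Obs d → ENNReal, Measurable F →
      ∫⁻ w, F (fb.observe (S a) w) * r a w ∂(ν : Measure (RewardVec d)) ≤
        ∫⁻ w, F (fb.observe (S a) w) ∂(ν' : Measure (RewardVec d)))
    (n : ℕ) {F : Hist fb K d n → ENNReal} (hF : Measurable F) :
    ∫⁻ h, F (observed fb S n h) * ∏ t, r (h t).1 (h t).2 ∂trajLaw S π ν n ≤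
      ∫⁻ h, F (observed fb S n h) ∂trajLaw S π ν' n := by
  have hr' : Measurable fun p : Fin K × RewardVec d => r p.1 p.2 :=
    measurable_from_prod_countable_right hr
  have hprod : ∀ n, Measurable fun h : Traj K d n => ∏ t, r (h t).1 (h t).2 := fun n =>
    Finset.measurable_fun_prod _ fun t _ => hr'.comp (measurable_pi_apply t)
  induction n with
  | zero => simp [trajLaw]
  | succ n ih =>
    have := π.markov n
    have hobs := measurable_observed fb S (n + 1)
    rw [lintegral_trajLaw_succ S π ν n
        (F := fun h => F (observed fb S (n + 1) h) * ∏ t, r (h t).1 (h t).2)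
        ((hF.comp hobs).mul (hprod _)),
      lintegral_trajLaw_succ S π ν' n (F := fun h => F (observed fb S (n + 1) h)) (hF.comp hobs)]
    simp only [observed_snoc, Fin.prod_univ_castSucc, Fin.snoc_castSucc, Fin.snoc_last]
    set G : Hist fb K d n → Fin K → ENNReal := fun y a =>
      ∫⁻ w, F (Fin.snoc (α := fun _ => Fin K × fb.Obs d) y (a, fb.observe (S a) w))
        ∂(ν' : Measure (RewardVec d))
    have hFs : ∀ a, Measurable fun p : Hist fb K d n × fb.Obs d =>
        F (Fin.snoc (α := fun _ => Fin K × fb.Obs d) p.1 (a, p.2)) := fun a =>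
      hF.comp ((measurable_snoc n).comp
        (measurable_fst.prodMk (measurable_const.prodMk measurable_snd)))
    have hGm : Measurable fun p : Hist fb K d n × Fin K => G p.1 p.2 := by
      refine measurable_from_prod_countable_left fun a => ?_
      exact Measurable.lintegral_prod_right ((hFs a).comp
        (measurable_fst.prodMk ((fb.measurable_observe (S a)).comp measurable_snd)))
    have hGi : Measurable fun y => ∫⁻ a, G y a ∂π.kernel n y :=
      Measurable.lintegral_kernel_prod_right hGm
    refine le_trans (lintegral_mono (g := fun h => (∫⁻ a, G (observed fb S n h) a
      ∂π.kernel n (observed fb S n h)) * ∏ t, r (h t).1 (h t).2) fun h => ?_) (ih hGi)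
    simp only
    rw [← lintegral_mul_const _ (measurable_of_countable _)]
    refine lintegral_mono fun a => ?_
    have hFa : Measurable fun y => F (Fin.snoc (α := fun _ => Fin K × fb.Obs d)
        (observed fb S n h) (a, y)) := (hFs a).comp measurable_prodMk_left
    calc _ = (∫⁻ w, F (Fin.snoc (α := fun _ => Fin K × fb.Obs d) (observed fb S n h)
          (a, fb.observe (S a) w)) * r a w ∂(ν : Measure (RewardVec d))) *
          ∏ t, r (h t).1 (h t).2 := by
          have hmul : Measurable fun w => F (Fin.snoc (α := fun _ => Fin K × fb.Obs d)
              (observed fb S n h) (a, fb.observe (S a) w)) * r a w :=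
            (hFa.comp (fb.measurable_observe (S a))).mul (hr a)
          rw [← lintegral_mul_const _ hmul]
          exact lintegral_congr fun w => by ring
      _ ≤ _ := by gcongr; exact hle a _ hFa

end TrajLaw

/-! ### Rewards and regret -/

theorem reward_nonneg {d : ℕ} (G : Finset (Fin d)) (w : RewardVec d) : 0 ≤ reward G w :=
  Finset.sum_nonneg fun e _ => (w e).2.1

theorem reward_le {d : ℕ} (G : Finset (Fin d)) (w : RewardVec d) : reward G w ≤ d := by
  calc reward G w ≤ ∑ _e ∈ G, (1 : ℝ) := Finset.sum_le_sum fun e _ => (w e).2.2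
    _ = (G.card : ℝ) := by simp
    _ ≤ d := by exact_mod_cast (Finset.card_le_univ G).trans_eq (Fintype.card_fin d)

theorem abs_reward_le {d : ℕ} (G : Finset (Fin d)) (w : RewardVec d) : |reward G w| ≤ d := by
  rw [abs_of_nonneg (reward_nonneg G w)]
  exact reward_le G w

theorem measurable_reward {d : ℕ} (G : Finset (Fin d)) : Measurable (reward G) := by
  show Measurable (fun w : RewardVec d => ∑ e ∈ G, (w e : ℝ))
  fun_prop

section Regret

variable {fb : Feedback} {K d : ℕ} (S : Fin K → Finset (Fin d)) (π : Policy fb K d)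
  (ν : ProbabilityMeasure (RewardVec d))

theorem armValue_eq_integral (i : Fin K) :
    armValue S ν i = ∫ w, reward (S i) w ∂(ν : Measure (RewardVec d)) := by
  have hint : ∀ e : Fin d, Integrable (fun w : RewardVec d => (w e : ℝ))
      (ν : Measure (RewardVec d)) := fun e =>
    Integrable.of_bound (by fun_prop : Measurable _).aestronglyMeasurable 1 (.of_forall fun w => by
      rw [Real.norm_of_nonneg (w e).2.1]; exact (w e).2.2)
  simp only [armValue, weight, mean, reward]
  rw [integral_finsetSum _ fun e _ => hint e]

theorem armValue_nonneg (i : Fin K) : 0 ≤ armValue S ν i := by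
  rw [armValue_eq_integral]
  exact integral_nonneg fun w => reward_nonneg _ w

theorem armValue_le (i : Fin K) : armValue S ν i ≤ d := by
  rw [armValue_eq_integral]
  calc _ ≤ ∫ _w, (d : ℝ) ∂(ν : Measure (RewardVec d)) :=
        integral_mono (Integrable.of_bound (measurable_reward _).aestronglyMeasurable d
          (.of_forall fun w => abs_reward_le _ w)) (integrable_const _) fun w => reward_le _ w
    _ = d := by simp

theorem armValue_le_optValue (i : Fin K) : armValue S ν i ≤ optValue S ν :=
  le_ciSup (Set.finite_range _).bddAbove i

theorem optValue_le : optValue S ν ≤ d :=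
  Real.iSup_le (fun i => armValue_le S ν i) (Nat.cast_nonneg d)

theorem optValue_eq_of_forall_le {i : Fin K} (h : ∀ k, armValue S ν k ≤ armValue S ν i) :
    optValue S ν = armValue S ν i :=
  have : Nonempty (Fin K) := ⟨i⟩
  le_antisymm (ciSup_le h) (armValue_le_optValue S ν i)

theorem integrable_arm (n : ℕ) (t : Fin n) (g : Fin K → ℝ) :
    Integrable (fun h => g (h t).1) (trajLaw S π ν n) :=
  Integrable.of_bound ((measurable_of_countable g).comp (measurable_arm t)).aestronglyMeasurable
    (∑ a, |g a|) (.of_forall fun _ =>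
      Finset.single_le_sum (f := fun a => |g a|) (fun _ _ => abs_nonneg _) (Finset.mem_univ _))

theorem regret_eq (n : ℕ) :
    regret S π ν n =
      ∑ t : Fin n, ∫ h, (optValue S ν - armValue S ν (h t).1) ∂trajLaw S π ν n := by
  refine Finset.sum_congr rfl fun t _ => ?_
  rw [integral_sub (integrable_const _) (integrable_arm S π ν n t _),
    integral_trajLaw_round S π ν n t (φ := fun a w => reward (S a) w)
      (fun a => measurable_reward _) (fun a w => abs_reward_le _ w)]
  simp [armValue_eq_integral]

theorem regret_nonneg (n : ℕ) : 0 ≤ regret S π ν n := by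
  rw [regret_eq]
  exact Finset.sum_nonneg fun t _ => integral_nonneg fun _ =>
    sub_nonneg.2 (armValue_le_optValue S ν _)

theorem regret_le (n : ℕ) : regret S π ν n ≤ n * d := by
  rw [regret_eq]
  calc _ ≤ ∑ _t : Fin n, (d : ℝ) := by
        refine Finset.sum_le_sum fun t _ => ?_
        calc _ ≤ ∫ _h, (d : ℝ) ∂trajLaw S π ν n :=
              integral_mono (integrable_arm S π ν n t fun a => optValue S ν - armValue S ν a)
                (integrable_const _) fun h => by
                  have := optValue_le S ν
                  have := armValue_nonneg S ν (h t).1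
                  simp only
                  linarith
          _ = d := by simp
    _ = n * d := by simp

/-- If each play of an arm `k` costs at least `δ * b k`, the regret is at least `δ` times the
expected sum of `b` over the played arms. For `b` the indicator of a set of arms, this sum is the
expected number of plays in that set. -/
theorem mul_sum_integral_le_regret (n : ℕ) {δ : ℝ} {b : Fin K → ℝ}
    (h : ∀ k, δ * b k ≤ optValue S ν - armValue S ν k) :
    δ * ∑ t : Fin n, ∫ h, b (h t).1 ∂trajLaw S π ν n ≤ regret S π ν n := by
  rw [regret_eq, Finset.mul_sum]
  refine Finset.sum_le_sum fun t _ => ?_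
  rw [← integral_const_mul]
  exact integral_mono (integrable_arm S π ν n t fun a => δ * b a)
    (integrable_arm S π ν n t fun a => optValue S ν - armValue S ν a) fun _ => h _

end Regret

namespace DesignPair

variable {fb : Feedback} {K d : ℕ} (P : DesignPair fb K d) (S : Fin K → Finset (Fin d))
  (ν : ProbabilityMeasure (RewardVec d)) (n : ℕ)

theorem gapError_nonneg (i j : Fin K) : 0 ≤ P.gapError S ν n i j :=
  integral_nonneg fun _ => abs_nonneg _

theorem maxError_nonneg : 0 ≤ P.maxError S ν n :=
  Real.iSup_nonneg fun _ => P.gapError_nonneg S ν n _ _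

theorem gapError_le_maxError {i j : Fin K} (h : i < j) :
    P.gapError S ν n i j ≤ P.maxError S ν n :=
  le_ciSup (f := fun p : {p : Fin K × Fin K // p.1 < p.2} => P.gapError S ν n p.1.1 p.1.2)
    (Set.finite_range _).bddAbove ⟨(i, j), h⟩

theorem maxError_le {B : ℝ} (hB : 0 ≤ B) (h : ∀ i j, i < j → P.gapError S ν n i j ≤ B) :
    P.maxError S ν n ≤ B :=
  Real.iSup_le (fun p => h _ _ p.2) hB

theorem ofReal_gapError {i j : Fin K}
    (h : Integrable (fun h => P.est n i j (observed fb S n h)) (P.law S ν n)) :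
    ENNReal.ofReal (P.gapError S ν n i j) =
      ∫⁻ h, ENNReal.ofReal |armGap S ν i j - P.est n i j (observed fb S n h)|
        ∂trajLaw S (P.policy n) ν n := by
  have : IsProbabilityMeasure (P.law S ν n) := isProbabilityMeasure_trajLaw S (P.policy n) ν n
  exact ofReal_integral_eq_lintegral_ofReal ((integrable_const _).sub h).abs
    (.of_forall fun _ => abs_nonneg _)

/-- Le Cam's two-point bound: if the observations under `ν₁` and `ν₂` dominate those under `ν`
weighted by `r₁` and `r₂`, no estimator is accurate for both `ν₁` and `ν₂`. -/
theorem lintegral_min_likelihood_le {ν ν₁ ν₂ : ProbabilityMeasure (RewardVec d)}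
    {r₁ r₂ : Fin K → RewardVec d → ENNReal}
    (hr₁ : ∀ a, Measurable (r₁ a)) (hr₂ : ∀ a, Measurable (r₂ a))
    (hle₁ : ∀ a, ∀ F : fb.Obs d → ENNReal, Measurable F →
      ∫⁻ w, F (fb.observe (S a) w) * r₁ a w ∂(ν : Measure (RewardVec d)) ≤
        ∫⁻ w, F (fb.observe (S a) w) ∂(ν₁ : Measure (RewardVec d)))
    (hle₂ : ∀ a, ∀ F : fb.Obs d → ENNReal, Measurable F →
      ∫⁻ w, F (fb.observe (S a) w) * r₂ a w ∂(ν : Measure (RewardVec d)) ≤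
        ∫⁻ w, F (fb.observe (S a) w) ∂(ν₂ : Measure (RewardVec d)))
    {i j : Fin K}
    (h₁ : Integrable (fun h => P.est n i j (observed fb S n h)) (P.law S ν₁ n))
    (h₂ : Integrable (fun h => P.est n i j (observed fb S n h)) (P.law S ν₂ n)) :
    ENNReal.ofReal |armGap S ν₁ i j - armGap S ν₂ i j| *
        ∫⁻ h, min (∏ t, r₁ (h t).1 (h t).2) (∏ t, r₂ (h t).1 (h t).2)
          ∂trajLaw S (P.policy n) ν n ≤
      ENNReal.ofReal (P.gapError S ν₁ n i j + P.gapError S ν₂ n i j) := by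
  have hm : ∀ {r : Fin K → RewardVec d → ENNReal}, (∀ a, Measurable (r a)) →
      Measurable fun h : Traj K d n => ∏ t, r (h t).1 (h t).2 := fun {r} hr =>
    Finset.measurable_fun_prod _ fun t _ =>
      (measurable_from_prod_countable_right (f := fun p => r p.1 p.2) hr).comp
        (measurable_pi_apply t)
  have hF : ∀ c : ℝ, Measurable fun y => ENNReal.ofReal |c - P.est n i j y| := fun c =>
    ENNReal.measurable_ofReal.comp
      (measurable_norm.comp (measurable_const.sub (P.measurable_est n i j)))
  rw [ENNReal.ofReal_add (P.gapError_nonneg S _ n i j) (P.gapError_nonneg S _ n i j),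
    P.ofReal_gapError S ν₁ n h₁, P.ofReal_gapError S ν₂ n h₂]
  refine le_trans ?_ (add_le_add
    (lintegral_mul_likelihood_le S (P.policy n) ν ν₁ hr₁ hle₁ n (hF _))
    (lintegral_mul_likelihood_le S (P.policy n) ν ν₂ hr₂ hle₂ n (hF _)))
  have hmul : Measurable fun h : Traj K d n =>
      ENNReal.ofReal |armGap S ν₁ i j - P.est n i j (observed fb S n h)| *
        ∏ t, r₁ (h t).1 (h t).2 := ((hF _).comp (measurable_observed fb S n)).mul (hm hr₁)
  rw [← lintegral_add_left hmul,
    ← lintegral_const_mul _ ((hm hr₁).min (hm hr₂))]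
  refine lintegral_mono fun h => ?_
  set y := P.est n i j (observed fb S n h)
  calc _ ≤ (ENNReal.ofReal |armGap S ν₁ i j - y| + ENNReal.ofReal |armGap S ν₂ i j - y|) *
        min (∏ t, r₁ (h t).1 (h t).2) (∏ t, r₂ (h t).1 (h t).2) := by
        gcongr
        rw [← ENNReal.ofReal_add (abs_nonneg _) (abs_nonneg _)]
        refine ENNReal.ofReal_le_ofReal ?_
        rw [abs_sub_comm (armGap S ν₂ i j) y]
        exact abs_sub_le _ _ _
    _ ≤ _ := by
        rw [add_mul]
        gcongr
        · exact min_le_left _ _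
        · exact min_le_right _ _

end DesignPair

/-! ### Affinity of two likelihoods -/

/-- For a likelihood ratio `L`, the expectation of the left-hand side is controlled: that of `L` is at
most `1` and that of `log L` is minus a divergence. -/
theorem min_one_ge {x : ℝ} (hx : 0 < x) : 3 / 4 + Real.log x / 2 - x / 4 ≤ min 1 x := by
  have h2 := Real.log_two_gt_d9
  have h2' := Real.log_two_lt_d9
  have h1 : Real.log x ≤ x / 2 - 1 + Real.log 2 := by
    have := Real.log_le_sub_one_of_pos (x := x / 2) (by positivity)
    rw [Real.log_div hx.ne' (by norm_num)] at this
    linarith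
  have h3 : Real.log x ≤ 2 * x - 1 - Real.log 2 := by
    have := Real.log_le_sub_one_of_pos (x := 2 * x) (by positivity)
    rw [Real.log_mul (by norm_num) hx.ne'] at this
    linarith
  refine le_min ?_ ?_ <;> linarith

/-- If each play of an arm `a` contributes at most `χ * b a` to the Kullback-Leibler divergence, then
the two laws of the history have a constant affinity as long as the expected sum of `b` over the
played arms is below `1 / χ` by a constant factor. -/
theorem integral_min_one_likelihood_ge {fb : Feedback} {K d : ℕ} (S : Fin K → Finset (Fin d))
    (π : Policy fb K d) (ν ν' : ProbabilityMeasure (RewardVec d))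
    {r : Fin K → RewardVec d → ℝ} (hr : ∀ a, Measurable (r a)) (hpos : ∀ a w, 0 < r a w)
    {B : ℝ} (hB : ∀ a w, r a w ≤ B) (hlog : ∀ a w, |Real.log (r a w)| ≤ B)
    (hle : ∀ a, ∀ F : fb.Obs d → ENNReal, Measurable F →
      ∫⁻ w, F (fb.observe (S a) w) * ENNReal.ofReal (r a w) ∂(ν : Measure (RewardVec d)) ≤
        ∫⁻ w, F (fb.observe (S a) w) ∂(ν' : Measure (RewardVec d)))
    {b : Fin K → ℝ} {χ : ℝ}
    (hχ : ∀ a, -(χ * b a) ≤ ∫ w, Real.log (r a w) ∂(ν : Measure (RewardVec d))) (n : ℕ) :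
    ENNReal.ofReal ((1 - χ * ∑ t : Fin n, ∫ h, b (h t).1 ∂trajLaw S π ν n) / 2) ≤
      ∫⁻ h, min 1 (∏ t, ENNReal.ofReal (r (h t).1 (h t).2)) ∂trajLaw S π ν n := by
  set μ := trajLaw S π ν n
  have hrm : ∀ t : Fin n, Measurable fun h : Traj K d n => r (h t).1 (h t).2 := fun t =>
    (measurable_from_prod_countable_right (f := fun p => r p.1 p.2) hr).comp
      (measurable_pi_apply t)
  set L : Traj K d n → ℝ := fun h => ∏ t, r (h t).1 (h t).2
  have hLm : Measurable L := Finset.measurable_fun_prod _ fun t _ => hrm t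
  have hLpos : ∀ h, 0 < L h := fun h => Finset.prod_pos fun t _ => hpos _ _
  have hLint : Integrable L μ :=
    Integrable.of_bound hLm.aestronglyMeasurable (∏ _t : Fin n, B) (.of_forall fun h => by
      rw [Real.norm_of_nonneg (hLpos h).le]
      exact Finset.prod_le_prod (fun t _ => (hpos _ _).le) fun t _ => hB _ _)
  have hlint : ∀ t : Fin n, Integrable (fun h => Real.log (r (h t).1 (h t).2)) μ := fun t =>
    Integrable.of_bound (Real.measurable_log.comp (hrm t)).aestronglyMeasurable B
      (.of_forall fun h => hlog _ _)
  have hlogL : ∀ h, Real.log (L h) = ∑ t, Real.log (r (h t).1 (h t).2) := fun h =>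
    Real.log_prod fun t _ => (hpos _ _).ne'
  have hlogLint : Integrable (fun h => Real.log (L h)) μ := by
    simp only [hlogL]
    exact integrable_finsetSum _ fun t _ => hlint t
  have hof : ∀ h, ∏ t, ENNReal.ofReal (r (h t).1 (h t).2) = ENNReal.ofReal (L h) := fun h =>
    (ENNReal.ofReal_prod_of_nonneg fun t _ => (hpos _ _).le).symm
  have hL1 : ∫ h, L h ∂μ ≤ 1 := by
    have h1 := lintegral_mul_likelihood_le S π ν ν' (r := fun a w => ENNReal.ofReal (r a w))
      (fun a => (hr a).ennreal_ofReal) hle n (F := 1) measurable_one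
    simp only [Pi.one_apply, one_mul, hof, lintegral_const, measure_univ, mul_one] at h1
    rw [← ofReal_integral_eq_lintegral_ofReal hLint (.of_forall fun h => (hLpos h).le)] at h1
    exact ENNReal.ofReal_le_one.1 h1
  have hlog1 : -(χ * ∑ t : Fin n, ∫ h, b (h t).1 ∂μ) ≤ ∫ h, Real.log (L h) ∂μ := by
    simp only [hlogL]
    rw [integral_finsetSum _ fun t _ => hlint t, Finset.mul_sum, ← Finset.sum_neg_distrib]
    refine Finset.sum_le_sum fun t _ => ?_
    rw [integral_trajLaw_round S π ν n t (φ := fun a w => Real.log (r a w))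
      (fun a => Real.measurable_log.comp (hr a)) hlog, ← integral_const_mul, ← integral_neg]
    exact integral_mono (integrable_arm S π ν n t fun a => -(χ * b a))
      (integrable_arm S π ν n t fun a => ∫ w, Real.log (r a w) ∂(ν : Measure (RewardVec d)))
      fun h => hχ _
  have hmin : Integrable (fun h => min 1 (L h)) μ := (integrable_const 1).inf hLint
  have hadd : Integrable (fun h => 3 / 4 + Real.log (L h) / 2) μ :=
    (integrable_const _).add (hlogLint.div_const 2)
  have hfin : (1 - χ * ∑ t : Fin n, ∫ h, b (h t).1 ∂μ) / 2 ≤ ∫ h, min 1 (L h) ∂μ := by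
    calc _ ≤ 3 / 4 + (∫ h, Real.log (L h) ∂μ) / 2 - (∫ h, L h ∂μ) / 4 := by linarith
      _ = ∫ h, (3 / 4 + Real.log (L h) / 2 - L h / 4) ∂μ := by
          rw [integral_sub hadd (hLint.div_const 4), integral_add (integrable_const _)
            (hlogLint.div_const 2)]
          simp [integral_div]
      _ ≤ _ := integral_mono (hadd.sub (hLint.div_const 4)) hmin fun h => min_one_ge (hLpos h)
  refine (ENNReal.ofReal_le_ofReal hfin).trans ?_
  rw [ofReal_integral_eq_lintegral_ofReal hmin
    (.of_forall fun h => le_min zero_le_one (hLpos h).le)]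
  refine lintegral_mono fun h => ?_
  simp only [hof]
  rw [ENNReal.ofReal_min, ENNReal.ofReal_one]

/-! ### A one-parameter family of hard instances -/

/-- The reward vector equal to `x` on `S j \ S i`, to `1 / 2` on `S i` and to `0` elsewhere. -/
def hardVec {K d : ℕ} (S : Fin K → Finset (Fin d)) (i j : Fin K) (x : unitInterval) :
    RewardVec d := fun e =>
  if e ∈ S j \ S i then x else if e ∈ S i then ⟨1 / 2, by norm_num, by norm_num⟩ else 0

/-- The instance that draws `hardVec S i j X` with `X` a Bernoulli variable of mean `p`. The arm `i`
is optimal for small `p`, the arm `j` for large `p`, and playing `i` reveals nothing about `p`. -/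
def hardLaw {K d : ℕ} (S : Fin K → Finset (Fin d)) (i j : Fin K) (p : unitInterval) :
    ProbabilityMeasure (RewardVec d) :=
  ⟨ENNReal.ofReal p • Measure.dirac (hardVec S i j 1) +
    ENNReal.ofReal (1 - p) • Measure.dirac (hardVec S i j 0), ⟨by
      simp [← ENNReal.ofReal_add p.2.1 (sub_nonneg.2 p.2.2)]⟩⟩

section HardLaw

variable {fb : Feedback} {K d m : ℕ} {S : Fin K → Finset (Fin d)} {i j : Fin K}

theorem lintegral_hardLaw (p : unitInterval) (F : RewardVec d → ENNReal) :
    ∫⁻ w, F w ∂(hardLaw S i j p : Measure (RewardVec d)) =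
      ENNReal.ofReal p * F (hardVec S i j 1) + ENNReal.ofReal (1 - p) * F (hardVec S i j 0) := by
  simp [hardLaw, lintegral_add_measure, lintegral_smul_measure]

theorem integral_hardLaw (p : unitInterval) (f : RewardVec d → ℝ) :
    ∫ w, f w ∂(hardLaw S i j p : Measure (RewardVec d)) =
      p * f (hardVec S i j 1) + (1 - p) * f (hardVec S i j 0) := by
  have h : ∀ v, Integrable f (Measure.dirac v) := fun v => integrable_dirac (by simp)
  simp only [hardLaw, ProbabilityMeasure.coe_mk]
  rw [integral_add_measure ((h _).smul_measure ENNReal.ofReal_ne_top)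
    ((h _).smul_measure ENNReal.ofReal_ne_top), integral_smul_measure, integral_smul_measure]
  simp [ENNReal.toReal_ofReal p.2.1, ENNReal.toReal_ofReal (sub_nonneg.2 p.2.2)]

theorem reward_hardVec (k : Fin K) (x : unitInterval) :
    reward (S k) (hardVec S i j x) =
      (S k ∩ (S j \ S i)).card * (x : ℝ) + (S k ∩ S i).card / 2 := by
  have h : ∀ e, (hardVec S i j x e : ℝ) =
      (if e ∈ S j \ S i then (x : ℝ) else 0) + (if e ∈ S i then 1 / 2 else 0) := by
    intro e
    by_cases h1 : e ∈ S i <;> by_cases h2 : e ∈ S j <;> simp [hardVec, h1, h2]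
  simp only [reward, weight, h, Finset.sum_add_distrib, Finset.sum_ite_mem, Finset.sum_const,
    nsmul_eq_mul]
  ring

theorem armValue_hardLaw (p : unitInterval) (k : Fin K) :
    armValue S (hardLaw S i j p) k =
      (S k ∩ (S j \ S i)).card * (p : ℝ) + (S k ∩ S i).card / 2 := by
  rw [armValue_eq_integral, integral_hardLaw, reward_hardVec, reward_hardVec]
  simp only [Set.Icc.coe_one, Set.Icc.coe_zero]
  ring

theorem observe_hardVec (x y : unitInterval) :
    fb.observe (S i) (hardVec S i j x) = fb.observe (S i) (hardVec S i j y) := by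
  cases fb with
  | fullBandit =>
    show reward _ _ = reward _ _
    simp [reward_hardVec]
  | semiBandit =>
    funext e
    by_cases h : e ∈ S i <;> simp [Feedback.observe, hardVec, h]

theorem lintegral_observe_hardLaw (p q : unitInterval) (F : fb.Obs d → ENNReal) :
    ∫⁻ w, F (fb.observe (S i) w) ∂(hardLaw S i j p : Measure (RewardVec d)) =
      ∫⁻ w, F (fb.observe (S i) w) ∂(hardLaw S i j q : Measure (RewardVec d)) := by
  simp only [lintegral_hardLaw, observe_hardVec (i := i) 1 0, ← add_mul]
  rw [← ENNReal.ofReal_add p.2.1 (sub_nonneg.2 p.2.2),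
    ← ENNReal.ofReal_add q.2.1 (sub_nonneg.2 q.2.2)]
  simp

theorem card_inter_sdiff_add_card_inter_le (k : Fin K) :
    (S k ∩ (S j \ S i)).card + (S k ∩ S i).card ≤ (S k).card := by
  rw [← Finset.card_union_of_disjoint]
  · exact Finset.card_le_card (Finset.union_subset Finset.inter_subset_left
      Finset.inter_subset_left)
  · exact Finset.disjoint_of_subset_left Finset.inter_subset_right
      (Finset.disjoint_of_subset_right Finset.inter_subset_right Finset.sdiff_disjoint)

theorem one_le_card_sdiff (hS : Function.Injective S) (hm : ∀ i, (S i).card = m) (hij : i ≠ j) :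
    1 ≤ (S j \ S i).card := by
  rw [Nat.one_le_iff_ne_zero, Finset.card_ne_zero, Finset.sdiff_nonempty]
  intro h
  exact hij (hS (Finset.eq_of_subset_of_card_le h (by rw [hm, hm])).symm)

theorem armValue_hardLaw_left (hm : ∀ i, (S i).card = m) (p : unitInterval) :
    armValue S (hardLaw S i j p) i = m / 2 := by
  rw [armValue_hardLaw]
  simp [hm]

theorem armValue_hardLaw_right (hm : ∀ i, (S i).card = m) (p : unitInterval) :
    armValue S (hardLaw S i j p) j = m / 2 - (S j \ S i).card * (1 / 2 - p) := by
  have h : (m : ℝ) = (S j \ S i).card + (S j ∩ S i).card := by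
    rw [← hm j, ← Finset.card_sdiff_add_card_inter (S j) (S i)]
    push_cast
    rfl
  rw [armValue_hardLaw, Finset.inter_eq_right.2 Finset.sdiff_subset, h]
  ring

theorem armGap_hardLaw (hm : ∀ i, (S i).card = m) (p : unitInterval) :
    armGap S (hardLaw S i j p) i j = (S j \ S i).card * (1 / 2 - p) := by
  rw [armGap, armValue_hardLaw_left hm, armValue_hardLaw_right hm]
  ring

theorem abs_sub_le_abs_armGap_hardLaw_sub (hS : Function.Injective S)
    (hm : ∀ i, (S i).card = m) (hij : i ≠ j) (p q : unitInterval) :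
    |(p : ℝ) - q| ≤
      |armGap S (hardLaw S i j p) i j - armGap S (hardLaw S i j q) i j| := by
  have h : (1 : ℝ) ≤ (S j \ S i).card := by exact_mod_cast one_le_card_sdiff hS hm hij
  rw [armGap_hardLaw hm, armGap_hardLaw hm, ← mul_sub, abs_mul, Nat.abs_cast, abs_sub_comm]
  calc |(q : ℝ) - p| ≤ (S j \ S i).card * |(q : ℝ) - p| := le_mul_of_one_le_left (abs_nonneg _) h
    _ = _ := by congr 2; ring

/-- For small `p` the arm `i` is the only optimal one. -/
theorem le_armValue_left_sub (hS : Function.Injective S) (hm : ∀ i, (S i).card = m) {δ : ℝ}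
    (hδ : 0 < δ) {p : unitInterval} (hp : (p : ℝ) ≤ 1 / 2 - δ) (k : Fin K) :
    δ * (if k = i then 0 else 1) ≤
      armValue S (hardLaw S i j p) i - armValue S (hardLaw S i j p) k := by
  split_ifs with h
  · simp [h]
  rw [armValue_hardLaw_left hm, armValue_hardLaw]
  have h1 := card_inter_sdiff_add_card_inter_le (S := S) (i := i) (j := j) k
  have h2 : (S k ∩ S i).card + 1 ≤ m := by
    by_contra! h3
    have h4 : S k ∩ S i = S i := Finset.eq_of_subset_of_card_le Finset.inter_subset_right
      (by rw [hm]; omega)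
    exact h (hS (Finset.eq_of_subset_of_card_le (Finset.inter_eq_right.1 h4)
      (by rw [hm, hm])).symm)
  rw [hm] at h1
  have h1' : ((S k ∩ (S j \ S i)).card : ℝ) + (S k ∩ S i).card ≤ m := by exact_mod_cast h1
  have h2' : ((S k ∩ S i).card : ℝ) + 1 ≤ m := by exact_mod_cast h2
  have hp0 := p.2.1
  nlinarith [mul_le_mul_of_nonneg_right h1' hp0]

theorem optValue_hardLaw_of_le (hS : Function.Injective S) (hm : ∀ i, (S i).card = m) {δ : ℝ}
    (hδ : 0 < δ) {p : unitInterval} (hp : (p : ℝ) ≤ 1 / 2 - δ) :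
    optValue S (hardLaw S i j p) = armValue S (hardLaw S i j p) i := by
  refine optValue_eq_of_forall_le S _ fun k => ?_
  have := le_armValue_left_sub (i := i) (j := j) hS hm hδ hp k
  split_ifs at this <;> linarith

theorem hardLaw_mem_instances_of_le (hS : Function.Injective S) (hm : ∀ i, (S i).card = m)
    {δ : ℝ} (hδ : 0 < δ) {p : unitInterval} (hp : (p : ℝ) ≤ 1 / 2 - δ) :
    hardLaw S i j p ∈ instances S δ := by
  intro k
  rw [optValue_hardLaw_of_le hS hm hδ hp]
  have := le_armValue_left_sub (i := i) (j := j) hS hm hδ hp k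
  split_ifs at this with h
  · exact .inl (by rw [h])
  · exact .inr (by linarith)

/-- For large `p` every arm is either as good as `j` or worse by a constant. -/
theorem armValue_right_eq_or_le (hm : ∀ i, (S i).card = m) {δ : ℝ} (hδ : 0 < δ)
    (hδ' : δ < 1 / 2) {p : unitInterval} (hp : 1 / 2 + δ ≤ (p : ℝ)) (k : Fin K) :
    armValue S (hardLaw S i j p) k = armValue S (hardLaw S i j p) j ∨
      δ ≤ armValue S (hardLaw S i j p) j - armValue S (hardLaw S i j p) k := by
  rw [armValue_hardLaw_right hm, armValue_hardLaw]
  have h1 := card_inter_sdiff_add_card_inter_le (S := S) (i := i) (j := j) k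
  have h2 : (S k ∩ (S j \ S i)).card ≤ (S j \ S i).card :=
    Finset.card_le_card Finset.inter_subset_right
  rw [hm] at h1
  generalize (S k ∩ (S j \ S i)).card = a at *
  generalize (S k ∩ S i).card = b at *
  generalize (S j \ S i).card = c at *
  have h1' : (a : ℝ) + b ≤ m := by exact_mod_cast h1
  rcases h2.eq_or_lt with rfl | h2
  · rcases h1.eq_or_lt with rfl | h1
    · left
      push_cast
      ring
    · right
      have h1'' : (a : ℝ) + b + 1 ≤ m := by exact_mod_cast h1
      linarith
  · right
    have h2' : (a : ℝ) + 1 ≤ c := by exact_mod_cast h2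
    nlinarith

theorem optValue_hardLaw_of_ge (hm : ∀ i, (S i).card = m) {δ : ℝ} (hδ : 0 < δ)
    (hδ' : δ < 1 / 2) {p : unitInterval} (hp : 1 / 2 + δ ≤ (p : ℝ)) :
    optValue S (hardLaw S i j p) = armValue S (hardLaw S i j p) j := by
  refine optValue_eq_of_forall_le S _ fun k => ?_
  rcases armValue_right_eq_or_le (i := i) (j := j) hm hδ hδ' hp k with h | h
  · exact h.le
  · linarith

theorem hardLaw_mem_instances_of_ge (hm : ∀ i, (S i).card = m) {δ : ℝ} (hδ : 0 < δ)
    (hδ' : δ < 1 / 2) {p : unitInterval} (hp : 1 / 2 + δ ≤ (p : ℝ)) :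
    hardLaw S i j p ∈ instances S δ := by
  intro k
  rw [optValue_hardLaw_of_ge hm hδ hδ' hp]
  exact armValue_right_eq_or_le hm hδ hδ' hp k

theorem le_optValue_hardLaw_sub_left (hS : Function.Injective S) (hm : ∀ i, (S i).card = m)
    (hij : i ≠ j) {δ : ℝ} (hδ : 0 < δ) (hδ' : δ < 1 / 2) {p : unitInterval}
    (hp : 1 / 2 + δ ≤ (p : ℝ)) :
    δ ≤ optValue S (hardLaw S i j p) - armValue S (hardLaw S i j p) i := by
  have h : (1 : ℝ) ≤ (S j \ S i).card := by exact_mod_cast one_le_card_sdiff hS hm hij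
  rw [optValue_hardLaw_of_ge hm hδ hδ' hp, armValue_hardLaw_right hm, armValue_hardLaw_left hm]
  nlinarith

/-! ### Two-point comparisons of hard instances -/

theorem hardVec_zero_ne_one (hS : Function.Injective S) (hm : ∀ i, (S i).card = m)
    (hij : i ≠ j) : hardVec S i j 0 ≠ hardVec S i j 1 := by
  obtain ⟨e, he⟩ := Finset.card_pos.1 (one_le_card_sdiff hS hm hij)
  intro h
  have := congrFun h e
  simp [hardVec, Finset.mem_sdiff.1 he] at this

/-- The likelihood ratio of one round between the parameters `q` and `p`. -/
def hardRatio (S : Fin K → Finset (Fin d)) (i j : Fin K) (p q : ℝ) (a : Fin K)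
    (w : RewardVec d) : ℝ :=
  if a = i then 1 else ({hardVec S i j 1} : Set (RewardVec d)).piecewise
    (fun _ => q / p) (fun _ => (1 - q) / (1 - p)) w

/-- The Kullback-Leibler divergence of two Bernoulli laws is at most their chi-square divergence. -/
theorem neg_chiSq_le_log_likelihood {p q : ℝ} (hp : 0 < p) (hp' : p < 1) (hq : 0 < q) (hq' : q < 1) :
    -((p - q) ^ 2 / (q * (1 - q))) ≤
      p * Real.log (q / p) + (1 - p) * Real.log ((1 - q) / (1 - p)) := by
  have h1 := Real.one_sub_inv_le_log_of_pos (div_pos hq hp)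
  have h2 := Real.one_sub_inv_le_log_of_pos (div_pos (sub_pos.2 hq') (sub_pos.2 hp'))
  have hq1 : 1 - q ≠ 0 := (sub_pos.2 hq').ne'
  calc -((p - q) ^ 2 / (q * (1 - q)))
      = p * (1 - (q / p)⁻¹) + (1 - p) * (1 - ((1 - q) / (1 - p))⁻¹) := by
        rw [inv_div, inv_div]
        field_simp
        ring
    _ ≤ _ := add_le_add (mul_le_mul_of_nonneg_left h1 hp.le)
        (mul_le_mul_of_nonneg_left h2 (sub_pos.2 hp').le)

/-- Two nearby parameters cannot be told apart when the regret is small. -/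
theorem abs_sub_mul_le_gapError_add (hS : Function.Injective S) (hm : ∀ i, (S i).card = m)
    (hij : i ≠ j) {δ : ℝ} (hδ : 0 < δ) {p q : unitInterval}
    (hp : 0 < (p : ℝ)) (hp' : (p : ℝ) ≤ 1 / 2 - δ) (hq : 0 < (q : ℝ)) (hq' : (q : ℝ) < 1)
    (P : DesignPair fb K d) (n : ℕ)
    (h₁ : Integrable (fun h => P.est n i j (observed fb S n h)) (P.law S (hardLaw S i j p) n))
    (h₂ : Integrable (fun h => P.est n i j (observed fb S n h)) (P.law S (hardLaw S i j q) n)) :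
    |(p : ℝ) - q| * ((1 - ((p : ℝ) - q) ^ 2 / (q * (1 - q)) *
        (P.regret S (hardLaw S i j p) n / δ)) / 2) ≤
      P.gapError S (hardLaw S i j p) n i j + P.gapError S (hardLaw S i j q) n i j := by
  have hp1 : (p : ℝ) < 1 := by linarith
  have hne := hardVec_zero_ne_one hS hm hij
  have hq0 := sub_pos.2 hq'
  have hp0 := sub_pos.2 hp1
  set r := hardRatio S i j p q with hr
  set b : Fin K → ℝ := fun k => if k = i then 0 else 1 with hb
  have hri : ∀ w, r i w = 1 := fun w => by simp [hr, hardRatio]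
  have hr1 : ∀ a, a ≠ i → r a (hardVec S i j 1) = q / p := fun a h => by simp [hr, hardRatio, h]
  have hr0 : ∀ a, a ≠ i → r a (hardVec S i j 0) = (1 - q) / (1 - p) := fun a h => by
    simp [hr, hardRatio, h, Set.piecewise, hne]
  have hcases : ∀ a w, r a w = 1 ∨ r a w = q / p ∨ r a w = (1 - q) / (1 - p) := by
    intro a w
    by_cases h : a = i <;> by_cases h' : w = hardVec S i j 1 <;>
      simp [hr, hardRatio, h, h', Set.piecewise]
  have hrm : ∀ a, Measurable (r a) := by
    intro a
    by_cases h : a = i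
    · rw [show r a = fun _ => 1 from funext fun w => by rw [h, hri]]
      exact measurable_const
    · have : r a = ({hardVec S i j 1} : Set (RewardVec d)).piecewise
          (fun _ => (q : ℝ) / p) (fun _ => (1 - q) / (1 - p)) := by
        funext w
        simp [hr, hardRatio, h]
      rw [this]
      exact Measurable.piecewise (measurableSet_singleton _) measurable_const measurable_const
  have hpos : ∀ a w, 0 < r a w := by
    intro a w
    rcases hcases a w with h | h | h <;> rw [h] <;> positivity
  have hle : ∀ a, ∀ F : fb.Obs d → ENNReal, Measurable F →
      ∫⁻ w, F (fb.observe (S a) w) * ENNReal.ofReal (r a w)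
          ∂(hardLaw S i j p : Measure (RewardVec d)) ≤
        ∫⁻ w, F (fb.observe (S a) w) ∂(hardLaw S i j q : Measure (RewardVec d)) := by
    intro a F _
    by_cases h : a = i
    · subst h
      simp only [hri, ENNReal.ofReal_one, mul_one]
      exact (lintegral_observe_hardLaw p q F).le
    · have e1 : ENNReal.ofReal p * ENNReal.ofReal (q / p) = ENNReal.ofReal q := by
        rw [← ENNReal.ofReal_mul hp.le, mul_div_cancel₀ _ hp.ne']
      have e2 : ENNReal.ofReal (1 - p) * ENNReal.ofReal ((1 - q) / (1 - p)) =
          ENNReal.ofReal (1 - q) := by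
        rw [← ENNReal.ofReal_mul hp0.le, mul_div_cancel₀ _ hp0.ne']
      rw [lintegral_hardLaw, lintegral_hardLaw, hr1 a h, hr0 a h, ← e1, ← e2]
      exact le_of_eq (by ring)
  have hχ : ∀ a, -(((p : ℝ) - q) ^ 2 / (q * (1 - q)) * b a) ≤
      ∫ w, Real.log (r a w) ∂(hardLaw S i j p : Measure (RewardVec d)) := by
    intro a
    rw [integral_hardLaw]
    by_cases h : a = i
    · simp [hb, h, hri]
    · rw [hr1 a h, hr0 a h]
      simpa [hb, h] using neg_chiSq_le_log_likelihood hp hp1 hq hq'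
  set B : ℝ := 1 + q / p + (1 - q) / (1 - p) + |Real.log (q / p)| +
    |Real.log ((1 - q) / (1 - p))| with hBdef
  have e1 : 0 < (q : ℝ) / p := by positivity
  have e2 : 0 < (1 - (q : ℝ)) / (1 - p) := by positivity
  have e3 := abs_nonneg (Real.log ((q : ℝ) / p))
  have e4 := abs_nonneg (Real.log ((1 - (q : ℝ)) / (1 - p)))
  have hB : ∀ a w, r a w ≤ B := by
    intro a w
    rcases hcases a w with h | h | h <;> rw [h, hBdef] <;> linarith
  have hBlog : ∀ a w, |Real.log (r a w)| ≤ B := by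
    intro a w
    rcases hcases a w with h | h | h <;> rw [h, hBdef]
    · rw [Real.log_one, abs_zero]
      positivity
    · linarith
    · linarith
  have hT : ∑ t : Fin n, ∫ h, b (h t).1 ∂trajLaw S (P.policy n) (hardLaw S i j p) n ≤
      P.regret S (hardLaw S i j p) n / δ := by
    rw [le_div_iff₀' hδ]
    refine mul_sum_integral_le_regret S (P.policy n) _ n fun k => ?_
    rw [optValue_hardLaw_of_le hS hm hδ hp']
    exact le_armValue_left_sub hS hm hδ hp' k
  have key := P.lintegral_min_likelihood_le S n (ν := hardLaw S i j p) (ν₁ := hardLaw S i j p)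
    (ν₂ := hardLaw S i j q) (r₁ := fun _ _ => 1) (r₂ := fun a w => ENNReal.ofReal (r a w))
    (fun _ => measurable_const) (fun a => (hrm a).ennreal_ofReal)
    (fun a F _ => by simp) hle h₁ h₂
  have haff := integral_min_one_likelihood_ge S (P.policy n) (hardLaw S i j p) (hardLaw S i j q)
    hrm hpos hB hBlog hle hχ n
  simp only [Finset.prod_const_one] at key
  have hfin := (mul_le_mul_right haff _).trans key
  rw [← ENNReal.ofReal_mul (abs_nonneg _), ENNReal.ofReal_le_ofReal_iff
    (add_nonneg (P.gapError_nonneg S _ n i j) (P.gapError_nonneg S _ n i j))] at hfin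
  have hsum := add_nonneg (P.gapError_nonneg S (hardLaw S i j p) n i j)
    (P.gapError_nonneg S (hardLaw S i j q) n i j)
  have hχ0 : 0 ≤ ((p : ℝ) - q) ^ 2 / (q * (1 - q)) := by positivity
  have hT' := mul_le_mul_of_nonneg_left hT hχ0
  rcases le_total 0 (1 - ((p : ℝ) - q) ^ 2 / (q * (1 - q)) *
      (P.regret S (hardLaw S i j p) n / δ)) with h0 | h0
  · refine le_trans (mul_le_mul (abs_sub_le_abs_armGap_hardLaw_sub hS hm hij p q) ?_
      (by positivity) (abs_nonneg _)) hfin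
    linarith
  · exact (mul_nonpos_of_nonneg_of_nonpos (abs_nonneg _) (by linarith)).trans hsum

/-- A policy whose regret is small when `i` is optimal plays only `i` with probability at least
`1 / 2`. -/
theorem half_le_lintegral_prod (hS : Function.Injective S) (hm : ∀ i, (S i).card = m)
    {δ : ℝ} (hδ : 0 < δ) {p : unitInterval} (hp : (p : ℝ) ≤ 1 / 2 - δ) (π : Policy fb K d) (n : ℕ)
    (hR : regret S π (hardLaw S i j p) n ≤ δ / 2) :
    ENNReal.ofReal (1 / 2) ≤ ∫⁻ h, ∏ t : Fin n, (if (h t).1 = i then 1 else 0 : ENNReal)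
      ∂trajLaw S π (hardLaw S i j p) n := by
  set μ := trajLaw S π (hardLaw S i j p) n
  set b : Fin K → ℝ := fun k => if k = i then 0 else 1 with hb
  have hb0 : ∀ k, 0 ≤ b k := fun k => by simp only [hb]; split_ifs <;> norm_num
  have hT : ∑ t : Fin n, ∫ h, b (h t).1 ∂μ ≤ 1 / 2 := by
    have := mul_sum_integral_le_regret S π (hardLaw S i j p) n (δ := δ) (b := b) fun k => by
      rw [optValue_hardLaw_of_le hS hm hδ hp]
      exact le_armValue_left_sub hS hm hδ hp k
    nlinarith
  have hbm : ∀ t : Fin n, Measurable fun h : Traj K d n => ENNReal.ofReal (b (h t).1) := fun t =>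
    (measurable_of_countable fun k => ENNReal.ofReal (b k)).comp (measurable_arm t)
  have h1 : (1 : ENNReal) ≤ (∫⁻ h, ∏ t : Fin n, (if (h t).1 = i then 1 else 0 : ENNReal) ∂μ) +
      ENNReal.ofReal (1 / 2) := by
    calc (1 : ENNReal) = ∫⁻ _h, 1 ∂μ := by simp [μ]
      _ ≤ ∫⁻ h, ((∏ t : Fin n, (if (h t).1 = i then 1 else 0 : ENNReal)) +
            ∑ t, ENNReal.ofReal (b (h t).1)) ∂μ := by
          refine lintegral_mono fun h => ?_
          by_cases H : ∀ t, (h t).1 = i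
          · simp [H]
          · push Not at H
            obtain ⟨t, ht⟩ := H
            refine le_add_left (le_trans ?_ (Finset.single_le_sum
              (f := fun t => ENNReal.ofReal (b (h t).1)) (fun _ _ => zero_le)
              (Finset.mem_univ t)))
            simp [hb, ht]
      _ = (∫⁻ h, ∏ t : Fin n, (if (h t).1 = i then 1 else 0 : ENNReal) ∂μ) +
            ENNReal.ofReal (∑ t : Fin n, ∫ h, b (h t).1 ∂μ) := by
          rw [lintegral_add_right _ (Finset.measurable_fun_sum _ fun t _ => hbm t),
            lintegral_finsetSum _ fun t _ => hbm t,
            ENNReal.ofReal_sum_of_nonneg fun t _ => integral_nonneg fun h => hb0 _]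
          congr 1
          refine Finset.sum_congr rfl fun t _ => ?_
          rw [ofReal_integral_eq_lintegral_ofReal (integrable_arm S π _ n t b)
            (.of_forall fun h => hb0 _)]
      _ ≤ _ := by gcongr
  have h2 : (1 : ENNReal) = ENNReal.ofReal (1 / 2) + ENNReal.ofReal (1 / 2) := by
    rw [← ENNReal.ofReal_add (by norm_num) (by norm_num)]
    norm_num
  exact (ENNReal.add_le_add_iff_right ENNReal.ofReal_ne_top).1 (h2.symm.trans_le h1)

/-- While only `i` is played, the histories under two parameters have the same law. -/
theorem lintegral_hardLaw_mul_prod_le (p q : unitInterval) (a : Fin K) (F : fb.Obs d → ENNReal) :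
    ∫⁻ w, F (fb.observe (S a) w) * (if a = i then 1 else 0)
        ∂(hardLaw S i j p : Measure (RewardVec d)) ≤
      ∫⁻ w, F (fb.observe (S a) w) ∂(hardLaw S i j q : Measure (RewardVec d)) := by
  by_cases h : a = i
  · subst h
    simpa using (lintegral_observe_hardLaw p q F).le
  · simp [h]

/-- If the regret is small where `i` is optimal, it is linear where `j` is. -/
theorem regret_ge_of_regret_small (hS : Function.Injective S) (hm : ∀ i, (S i).card = m)
    (hij : i ≠ j) {δ : ℝ} (hδ : 0 < δ) (hδ' : δ < 1 / 2) {p q : unitInterval}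
    (hp : (p : ℝ) ≤ 1 / 2 - δ) (hq : 1 / 2 + δ ≤ (q : ℝ)) (π : Policy fb K d) (n : ℕ)
    (hR : regret S π (hardLaw S i j p) n ≤ δ / 2) :
    n * (δ / 2) ≤ regret S π (hardLaw S i j q) n := by
  set b : Fin K → ℝ := fun k => if k = i then 1 else 0 with hb
  have hb0 : ∀ k, 0 ≤ b k := fun k => by simp only [hb]; split_ifs <;> norm_num
  have h1 := mul_sum_integral_le_regret S π (hardLaw S i j q) n (δ := δ) (b := b) fun k => by
    by_cases h : k = i
    · simpa [hb, h] using le_optValue_hardLaw_sub_left hS hm hij hδ hδ' hq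
    · simpa [hb, h] using armValue_le_optValue S (hardLaw S i j q) k
  have h2 : ∀ t : Fin n, 1 / 2 ≤ ∫ h, b (h t).1 ∂trajLaw S π (hardLaw S i j q) n := by
    intro t
    have hF : Measurable fun y : Hist fb K d n => ENNReal.ofReal (b (y t).1) :=
      (measurable_of_countable fun k => ENNReal.ofReal (b k)).comp
        (measurable_fst.comp (measurable_pi_apply t))
    have h3 := lintegral_mul_likelihood_le S π (hardLaw S i j p) (hardLaw S i j q)
      (r := fun a _ => if a = i then 1 else 0) (fun a => measurable_const)
      (fun a F _ => lintegral_hardLaw_mul_prod_le p q a F) n hF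
    have h4 := half_le_lintegral_prod hS hm hδ hp π n hR
    rw [← ENNReal.ofReal_le_ofReal_iff (integral_nonneg fun h => hb0 _),
      ofReal_integral_eq_lintegral_ofReal (integrable_arm S π _ n t b)
        (.of_forall fun h => hb0 _)]
    refine h4.trans (le_trans (lintegral_mono fun h => ?_) h3)
    by_cases H : (h t).1 = i
    · simp [observed, hb, H]
    · rw [Finset.prod_eq_zero (Finset.mem_univ t) (by simp [H])]
      exact zero_le
  refine le_trans ?_ h1
  calc n * (δ / 2) = δ * ∑ _t : Fin n, (1 / 2 : ℝ) := by simp; ring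
    _ ≤ _ := by gcongr with t; exact h2 t

/-- If the regret is small where `i` is optimal, no two parameters can be told apart. -/
theorem gapError_add_ge_of_regret_small (hS : Function.Injective S) (hm : ∀ i, (S i).card = m)
    (hij : i ≠ j) {δ : ℝ} (hδ : 0 < δ) {p q₁ q₂ : unitInterval} (hp : (p : ℝ) ≤ 1 / 2 - δ)
    (P : DesignPair fb K d) (n : ℕ) (hR : P.regret S (hardLaw S i j p) n ≤ δ / 2)
    (h₁ : Integrable (fun h => P.est n i j (observed fb S n h)) (P.law S (hardLaw S i j q₁) n))
    (h₂ : Integrable (fun h => P.est n i j (observed fb S n h)) (P.law S (hardLaw S i j q₂) n)) :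
    |(q₁ : ℝ) - q₂| / 2 ≤
      P.gapError S (hardLaw S i j q₁) n i j + P.gapError S (hardLaw S i j q₂) n i j := by
  have key := P.lintegral_min_likelihood_le S n (ν := hardLaw S i j p)
    (r₁ := fun a _ => if a = i then 1 else 0) (r₂ := fun a _ => if a = i then 1 else 0)
    (fun _ => measurable_const) (fun _ => measurable_const)
    (fun a F _ => lintegral_hardLaw_mul_prod_le p q₁ a F)
    (fun a F _ => lintegral_hardLaw_mul_prod_le p q₂ a F) h₁ h₂
  simp only [min_self] at key
  have hfin := (mul_le_mul_right
    (half_le_lintegral_prod hS hm hδ hp (P.policy n) n hR) _).trans key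
  rw [← ENNReal.ofReal_mul (abs_nonneg _), ENNReal.ofReal_le_ofReal_iff
    (add_nonneg (P.gapError_nonneg S _ n i j) (P.gapError_nonneg S _ n i j))] at hfin
  have := abs_sub_le_abs_armGap_hardLaw_sub (j := j) hS hm hij q₁ q₂
  linarith

end HardLaw

/-! ### The lower bound on the product -/

/-- A bounded nonnegative function has a maximiser up to a factor `2`. -/
theorem exists_forall_le_two_mul {α : Type*} {s : Set α} (hs : s.Nonempty) {f : α → ℝ}
    (h0 : ∀ x ∈ s, 0 ≤ f x) {B : ℝ} (hB : ∀ x ∈ s, f x ≤ B) :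
    ∃ x ∈ s, ∀ y ∈ s, f y ≤ 2 * f x := by
  have hbdd : BddAbove (f '' s) := ⟨B, by rintro _ ⟨x, hx, rfl⟩; exact hB x hx⟩
  by_cases h : ∃ x ∈ s, 0 < f x
  · obtain ⟨x, hx, hx0⟩ := h
    have hpos : 0 < sSup (f '' s) := hx0.trans_le (le_csSup hbdd ⟨x, hx, rfl⟩)
    obtain ⟨_, ⟨y, hy, rfl⟩, hlt⟩ := exists_lt_of_lt_csSup (hs.image f) (half_lt_self hpos)
    exact ⟨y, hy, fun z hz => by linarith [le_csSup hbdd ⟨z, hz, rfl⟩]⟩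
  · push Not at h
    obtain ⟨x, hx⟩ := hs
    exact ⟨x, hx, fun y hy => by linarith [h y hy, h0 x hx]⟩

/-- No admissible pair beats the rate `error * √regret = 1` on all instances simultaneously. -/
theorem exists_le_maxError_mul_sqrt_regret {fb : Feedback} {d K m : ℕ}
    {S : Fin K → Finset (Fin d)} (hS : Function.Injective S) (hm : ∀ i, (S i).card = m)
    (hK : 2 ≤ K) {δ : ℝ} (hδ : 0 < δ) (hδ' : δ < 1 / 2) {P : DesignPair fb K d}
    (hP : P.IsAdmissible S (instances S δ)) :
    ∃ c > 0, ∀ n ≥ 1, ∃ ν ∈ instances S δ, c ≤ P.maxError S ν n * √(P.regret S ν n) := by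
  obtain ⟨B, hB⟩ := hP
  let i : Fin K := ⟨0, by omega⟩
  let j : Fin K := ⟨1, by omega⟩
  have hij : i < j := by simp [i, j]
  set θ : ℝ := 1 / 2 - δ with hθ
  have hθ0 : 0 < θ := by linarith
  have hint : ∀ n, ∀ p : unitInterval, hardLaw S i j p ∈ instances S δ →
      Integrable (fun h => P.est n i j (observed fb S n h)) (P.law S (hardLaw S i j p) n) :=
    fun n p hp => (hB n _ hp i j hij).1
  have hlow : ∀ p : unitInterval, (p : ℝ) ≤ θ → hardLaw S i j p ∈ instances S δ := fun p hp =>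
    hardLaw_mem_instances_of_le hS hm hδ hp
  have hsqrtδ : 0 < √(δ / 2) := Real.sqrt_pos.2 (by linarith)
  -- `c₁ / √regret` is the distance of the two parameters that are compared: it has to fit into
  -- `[θ / 2, θ]`, and their divergence has to stay bounded.
  set c₁ : ℝ := min (√(θ / 4 * δ / 2)) (θ / 4 * √(δ / 2))
  have hc₁pos : 0 < c₁ := lt_min (Real.sqrt_pos.2 (by positivity)) (by positivity)
  refine ⟨min (θ / 4 * √(δ / 2)) (c₁ / 16), lt_min (by positivity) (by positivity), ?_⟩
  intro n hn
  by_cases hsmall : ∃ p : unitInterval, (p : ℝ) ≤ θ ∧ P.regret S (hardLaw S i j p) n ≤ δ / 2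
  · obtain ⟨p, hp, hR⟩ := hsmall
    have key : ∀ q : unitInterval, 1 / 2 + δ ≤ (q : ℝ) →
        θ / 4 ≤ P.gapError S (hardLaw S i j q) n i j →
        ∃ ν ∈ instances S δ, min (θ / 4 * √(δ / 2)) (c₁ / 16) ≤
          P.maxError S ν n * √(P.regret S ν n) := by
      intro q hq hE
      refine ⟨hardLaw S i j q, hardLaw_mem_instances_of_ge hm hδ hδ' hq, (min_le_left _ _).trans ?_⟩
      refine mul_le_mul (hE.trans (P.gapError_le_maxError S _ n hij)) (Real.sqrt_le_sqrt ?_)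
        (Real.sqrt_nonneg _) (P.maxError_nonneg S _ n)
      refine le_trans ?_ (regret_ge_of_regret_small hS hm hij.ne hδ hδ' hp hq (P.policy n) n hR)
      have : (1 : ℝ) ≤ n := by exact_mod_cast hn
      nlinarith
    let q₁ : unitInterval := 1
    let q₂ : unitInterval := ⟨1 / 2 + δ, by linarith, by linarith⟩
    have hq₁ : 1 / 2 + δ ≤ (q₁ : ℝ) := by simp only [q₁, Set.Icc.coe_one]; linarith
    have hq₂ : 1 / 2 + δ ≤ (q₂ : ℝ) := le_rfl
    have hsum := gapError_add_ge_of_regret_small hS hm hij.ne hδ hp P n hR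
      (hint n q₁ (hardLaw_mem_instances_of_ge hm hδ hδ' hq₁))
      (hint n q₂ (hardLaw_mem_instances_of_ge hm hδ hδ' hq₂))
    have habs : |(q₁ : ℝ) - q₂| = θ := by
      simp only [q₁, q₂, Set.Icc.coe_one]
      rw [abs_of_nonneg (by linarith)]
      linarith
    rw [habs] at hsum
    by_cases hE : θ / 4 ≤ P.gapError S (hardLaw S i j q₁) n i j
    · exact key q₁ hq₁ hE
    · exact key q₂ hq₂ (by linarith)
  · push Not at hsmall
    -- Since the regret is nearly minimal at `p`, it cannot be much smaller at the parameter `q`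
    -- with which `p` is compared.
    obtain ⟨p, ⟨hp1, hp2⟩, hmin⟩ := exists_forall_le_two_mul
      (s := {p : unitInterval | θ / 2 ≤ (p : ℝ) ∧ (p : ℝ) ≤ θ})
      (f := fun p => (P.regret S (hardLaw S i j p) n)⁻¹) (B := (δ / 2)⁻¹)
      ⟨⟨θ, by linarith, by linarith⟩, ⟨by show θ / 2 ≤ θ; linarith, le_refl θ⟩⟩
      (fun p _ => inv_nonneg.2 (regret_nonneg S _ _ n))
      (fun p hp => inv_anti₀ (by linarith) (hsmall p hp.2).le)
    set R := P.regret S (hardLaw S i j p) n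
    have hR : δ / 2 < R := hsmall p hp2
    have hR0 : 0 < R := by linarith
    have hsR : √(δ / 2) ≤ √R := Real.sqrt_le_sqrt hR.le
    have hsR0 : 0 < √R := Real.sqrt_pos.2 hR0
    have hsq : √R ^ 2 = R := Real.sq_sqrt hR0.le
    set ε := c₁ / √R with hε
    have hε0 : 0 < ε := by positivity
    have hεθ : ε ≤ θ / 4 := by
      rw [hε, div_le_iff₀ hsR0]
      exact (min_le_right _ _).trans (by gcongr)
    have hε2 : ε ^ 2 * R ≤ θ / 4 * δ / 2 := by
      have h1 : ε ^ 2 * R = c₁ ^ 2 := by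
        rw [hε, div_pow, hsq, div_mul_cancel₀ _ hR0.ne']
      rw [h1, ← Real.sq_sqrt (show 0 ≤ θ / 4 * δ / 2 by positivity)]
      exact pow_le_pow_left₀ hc₁pos.le (min_le_left _ _) 2
    obtain ⟨q, hq1, hq2, hpq⟩ : ∃ q : unitInterval, θ / 2 ≤ (q : ℝ) ∧ (q : ℝ) ≤ θ ∧
        |(p : ℝ) - q| = ε := by
      by_cases h : (p : ℝ) + ε ≤ θ
      · refine ⟨⟨p + ε, by linarith, by linarith⟩, ?_, h, ?_⟩
        · simp only
          linarith
        · simp [abs_of_pos hε0]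
      · refine ⟨⟨p - ε, by linarith, by linarith⟩, ?_, ?_, ?_⟩
        · simp only
          linarith
        · simp only
          linarith
        · simp [abs_of_pos hε0]
    have hE := abs_sub_mul_le_gapError_add hS hm hij.ne hδ (by linarith) hp2
      (by linarith) (by linarith) P n (hint n p (hlow p hp2)) (hint n q (hlow q hq2))
    rw [← sq_abs ((p : ℝ) - q), hpq] at hE
    have hχ : ε ^ 2 / (q * (1 - q)) * (R / δ) ≤ 1 / 2 := by
      have hκ : θ / 4 ≤ q * (1 - q) := by nlinarith
      rw [div_mul_div_comm, div_le_iff₀ (by nlinarith)]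
      nlinarith
    have hE' : ε / 4 ≤ P.gapError S (hardLaw S i j p) n i j +
        P.gapError S (hardLaw S i j q) n i j := by
      refine le_trans ?_ hE
      nlinarith
    by_cases hEp : ε / 8 ≤ P.gapError S (hardLaw S i j p) n i j
    · refine ⟨hardLaw S i j p, hlow p hp2, (min_le_right _ _).trans ?_⟩
      calc c₁ / 16 ≤ c₁ / 8 := by linarith
        _ = ε / 8 * √R := by rw [hε]; field_simp
        _ ≤ _ := by
          gcongr
          exact hEp.trans (P.gapError_le_maxError S _ n hij)
    · refine ⟨hardLaw S i j q, hlow q hq2, (min_le_right _ _).trans ?_⟩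
      have hRq : R / 2 ≤ P.regret S (hardLaw S i j q) n := by
        have h0 : 0 < P.regret S (hardLaw S i j q) n := by linarith [hsmall q hq2]
        have := hmin q ⟨hq1, hq2⟩
        rw [← div_eq_mul_inv, inv_le_comm₀ h0 (by positivity), inv_div] at this
        exact this
      have hs : √R / 2 ≤ √(P.regret S (hardLaw S i j q) n) := by
        refine Real.le_sqrt_of_sq_le ?_
        rw [div_pow, hsq]
        linarith
      calc c₁ / 16 = ε / 8 * (√R / 2) := by rw [hε]; field_simp; norm_num
        _ ≤ _ := by
          refine mul_le_mul (le_trans ?_ (P.gapError_le_maxError S _ n hij)) hs (by positivity)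
            (P.maxError_nonneg S _ n)
          linarith

/-! ### Explore-then-commit -/

/-- The total reward of the played super arm, which both kinds of feedback reveal. -/
def Feedback.obsReward (fb : Feedback) {d : ℕ} (o : fb.Obs d) : ℝ :=
  match fb, o with
  | .fullBandit, (x : ℝ) => x
  | .semiBandit, (x : Fin d → ℝ) => ∑ e, x e

theorem Feedback.obsReward_observe (fb : Feedback) {d : ℕ} (G : Finset (Fin d))
    (w : RewardVec d) : fb.obsReward (fb.observe G w) = reward G w := by
  cases fb with
  | fullBandit => rfl
  | semiBandit =>
    show ∑ e, (if e ∈ G then (w e : ℝ) else 0) = ∑ e ∈ G, (w e : ℝ)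
    simp

theorem Feedback.measurable_obsReward (fb : Feedback) {d : ℕ} :
    Measurable (fb.obsReward (d := d)) := by
  cases fb with
  | fullBandit => exact measurable_id
  | semiBandit =>
    show Measurable fun x : Fin d → ℝ => ∑ e, x e
    fun_prop

section Argmax

variable {K : ℕ} [Nonempty (Fin K)]

/-- An index at which `v` is maximal. The choice depends only on the set of maximisers, which makes
it measurable. -/
def argmax (v : Fin K → ℝ) : Fin K := Classical.epsilon fun k => ∀ j, v j ≤ v k

theorem le_argmax (v : Fin K → ℝ) (j : Fin K) : v j ≤ v (argmax v) :=
  Classical.epsilon_spec (p := fun k => ∀ j, v j ≤ v k) (Finite.exists_max v) j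

theorem measurable_argmax : Measurable (argmax (K := K)) := by
  have h : Measurable fun v : Fin K → ℝ => {k | ∀ j, v j ≤ v k} := by
    refine measurable_set_iff.2 fun k => measurableSet_setOfPred.1 ?_
    have : {v : Fin K → ℝ | k ∈ {k | ∀ j, v j ≤ v k}} = ⋂ j, {v | v j ≤ v k} := by
      ext v
      simp
    rw [this]
    exact MeasurableSet.iInter fun j =>
      measurableSet_le (measurable_pi_apply j) (measurable_pi_apply k)
  exact (measurable_of_finite fun s : Set (Fin K) => Classical.epsilon fun k => k ∈ s).comp h

end Argmax

/-- The average reward observed in the `a`-th block of `N` rounds. -/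
def empMean (fb : Feedback) {K d : ℕ} (N : ℕ) {t : ℕ} (y : Hist fb K d t) (a : Fin K) : ℝ :=
  (∑ s : Fin t, if (s : ℕ) / N = a then fb.obsReward (y s).2 else 0) / N

theorem measurable_empMean (fb : Feedback) {K d : ℕ} (N t : ℕ) :
    Measurable (empMean fb N : Hist fb K d t → Fin K → ℝ) := by
  refine measurable_pi_lambda _ fun a => ?_
  refine (Finset.measurable_fun_sum _ fun s _ => ?_).div_const _
  by_cases h : (s : ℕ) / N = a
  · simp only [h, if_true]
    exact fb.measurable_obsReward.comp (measurable_snd.comp (measurable_pi_apply s))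
  · simp only [h, if_false]
    exact measurable_const

/-- Play the arms in consecutive blocks of `N` rounds each, then commit to the arm with the best
empirical mean. -/
def etcArm (fb : Feedback) {K d : ℕ} [Nonempty (Fin K)] (N t : ℕ) (y : Hist fb K d t) : Fin K :=
  if h : t / N < K then ⟨t / N, h⟩ else argmax (empMean fb N y)

theorem measurable_etcArm (fb : Feedback) {K d : ℕ} [Nonempty (Fin K)] (N t : ℕ) :
    Measurable (etcArm fb N t : Hist fb K d t → Fin K) := by
  by_cases h : t / N < K
  · rw [show (etcArm fb N t : Hist fb K d t → Fin K) = fun _ => ⟨t / N, h⟩ from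
      funext fun y => dif_pos h]
    exact measurable_const
  · rw [show (etcArm fb N t : Hist fb K d t → Fin K) = fun y => argmax (empMean fb N y) from
      funext fun y => dif_neg h]
    exact measurable_argmax.comp (measurable_empMean fb N t)

/-- The explore-then-commit policy. -/
def etcPolicy (fb : Feedback) (K d : ℕ) [Nonempty (Fin K)] (N : ℕ) : Policy fb K d where
  kernel t := Kernel.deterministic (etcArm fb N t) (measurable_etcArm fb N t)
  markov _ := inferInstance

section ETC

variable {fb : Feedback} {K d : ℕ} (S : Fin K → Finset (Fin d))
  (ν : ProbabilityMeasure (RewardVec d)) {N : ℕ} {n : ℕ}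

/-- The average reward of arm `a` over the `a`-th block of `N` rounds, whichever arm is played
there. -/
def blockMean (N : ℕ) (h : Traj K d n) (a : Fin K) : ℝ :=
  (∑ s : Fin n, if (s : ℕ) / N = a then reward (S a) (h s).2 else 0) / N

theorem measurable_blockMean (N : ℕ) (a : Fin K) :
    Measurable fun h : Traj K d n => blockMean S N h a := by
  refine (Finset.measurable_fun_sum _ fun s _ => ?_).div_const _
  by_cases h : (s : ℕ) / N = a
  · simp only [h, if_true]
    exact (measurable_reward _).comp (measurable_snd.comp (measurable_pi_apply s))
  · simp only [h, if_false]
    exact measurable_const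

theorem blockMean_snoc (hn : ¬ n / N < K) (h : Traj K d n) (p : Fin K × RewardVec d) (a : Fin K) :
    blockMean S N (Fin.snoc (α := fun _ => Fin K × RewardVec d) h p) a = blockMean S N h a := by
  have ha : n / N ≠ a := fun h => hn (h ▸ a.2)
  simp [blockMean, Fin.sum_univ_castSucc, ha]

theorem empMean_observed {h : Traj K d n}
    (hh : ∀ s : Fin n, ∀ hs : (s : ℕ) / N < K, (h s).1 = ⟨s / N, hs⟩) :
    empMean fb N (observed fb S n h) = blockMean S N h := by
  funext a
  refine congrArg (· / (N : ℝ)) (Finset.sum_congr rfl fun s _ => ?_)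
  by_cases hs : (s : ℕ) / N = a
  · have ha : (h s).1 = a := by
      rw [hh s (hs ▸ a.2)]
      exact Fin.ext hs
    simp only [hs, if_true, observed, fb.obsReward_observe, ha]
  · simp only [hs, if_false]

variable [Nonempty (Fin K)]

/-- The arms that the explore-then-commit policy plays, as a function of the rewards. -/
theorem ae_etcPolicy (N n : ℕ) :
    ∀ᵐ h ∂trajLaw S (etcPolicy fb K d N) ν n, ∀ t : Fin n,
      (h t).1 = if ht : (t : ℕ) / N < K then ⟨t / N, ht⟩ else argmax (blockMean S N h) := by
  have hmeas : ∀ n, MeasurableSet {h : Traj K d n | ∀ t : Fin n,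
      (h t).1 = if ht : (t : ℕ) / N < K then ⟨t / N, ht⟩ else argmax (blockMean S N h)} := by
    intro n
    rw [Set.ofPred_forall]
    refine MeasurableSet.iInter fun t => measurableSet_eq_fun (measurable_arm t) ?_
    split_ifs
    · exact measurable_const
    · exact measurable_argmax.comp (measurable_pi_lambda _ fun a => measurable_blockMean S N a)
  induction n with
  | zero => exact .of_forall fun h t => t.elim0
  | succ n ih =>
    rw [ae_iff, ← Set.compl_ofPred, ← lintegral_indicator_one (hmeas _).compl,
      lintegral_trajLaw_succ S _ ν n (measurable_one.indicator (hmeas _).compl)]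
    rw [← lintegral_zero (μ := trajLaw S (etcPolicy fb K d N) ν n)]
    refine lintegral_congr_ae ?_
    filter_upwards [ih] with h hh
    have hobs : empMean fb N (observed fb S n h) = blockMean S N h :=
      empMean_observed S fun s hs => by rw [hh s, dif_pos hs]
    simp only [etcPolicy]
    rw [Kernel.lintegral_deterministic, ← lintegral_zero (μ := (ν : Measure (RewardVec d)))]
    refine lintegral_congr fun w => Set.indicator_of_notMem ?_ _
    rw [Set.notMem_compl_iff]
    intro t
    induction t using Fin.lastCases with
    | last =>
      simp only [Fin.snoc_last, Fin.val_last, etcArm, hobs]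
      split_ifs with hn
      · rfl
      · rw [funext (blockMean_snoc S hn h _)]
    | cast t =>
      simp only [Fin.snoc_castSucc, Fin.val_castSucc]
      rw [hh t]
      split_ifs with ht
      · rfl
      · have hn : ¬ n / N < K := fun hn => ht ((Nat.div_le_div_right t.2.le).trans_lt hn)
        rw [funext (blockMean_snoc S hn h _)]

end ETC

/-! ### Concentration of the block means -/

theorem hasSubgaussianMGF_sum_pi {Ω : Type*} [MeasurableSpace Ω] {μ : Measure Ω}
    [IsProbabilityMeasure μ] {X : Ω → ℝ} (hX : Measurable X) {c : NNReal}
    (h : HasSubgaussianMGF X c μ) {n : ℕ} (s : Finset (Fin n)) :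
    HasSubgaussianMGF (fun w : Fin n → Ω => ∑ i ∈ s, X (w i)) (s.card * c)
      (Measure.pi fun _ : Fin n => μ) := by
  have hind : iIndepFun (fun (i : Fin n) (w : Fin n → Ω) => X (w i))
      (Measure.pi fun _ : Fin n => μ) := iIndepFun_pi fun _ => hX.aemeasurable
  have hsum := HasSubgaussianMGF.sum_of_iIndepFun hind (c := fun _ => c) (s := s) fun i _ => by
    have hmp := measurePreserving_eval (fun _ : Fin n => μ) i
    rw [← hmp.map_eq] at h
    exact h.of_map hmp.measurable.aemeasurable
  simpa using hsum

section Concentration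

variable {fb : Feedback} {K d : ℕ} (S : Fin K → Finset (Fin d)) (π : Policy fb K d)
  (ν : ProbabilityMeasure (RewardVec d)) {N n : ℕ}

/-- The rounds of the `a`-th block of length `N`. -/
def block (N n a : ℕ) : Finset (Fin n) := Finset.univ.filter fun s => (s : ℕ) / N = a

theorem card_block {a : ℕ} (hN : 0 < N) (ha : a < K) (hn : K * N ≤ n) :
    (block N n a).card = N := by
  have h1 : (block N n a).map Fin.valEmbedding = Finset.Ico (a * N) ((a + 1) * N) := by
    ext s
    have h2 : (a + 1) * N ≤ K * N := Nat.mul_le_mul_right N ha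
    simp only [block, Finset.mem_map, Finset.mem_filter, Finset.mem_univ, true_and,
      Fin.valEmbedding_apply, Finset.mem_Ico]
    constructor
    · rintro ⟨t, ht, rfl⟩
      exact ⟨(Nat.le_div_iff_mul_le hN).1 ht.ge,
        (Nat.div_lt_iff_lt_mul hN).1 (ht ▸ Nat.lt_succ_self _)⟩
    · rintro ⟨h3, h4⟩
      refine ⟨⟨s, by omega⟩, le_antisymm ?_ ?_, rfl⟩
      · exact Nat.lt_succ_iff.1 ((Nat.div_lt_iff_lt_mul hN).2 h4)
      · exact (Nat.le_div_iff_mul_le hN).2 h3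
  rw [← Finset.card_map Fin.valEmbedding, h1, Nat.card_Ico, ← Nat.sub_mul]
  simp

/-- The centred total reward of arm `a` over its block. -/
def deviation (N : ℕ) (a : Fin K) (h : Traj K d n) : ℝ :=
  ∑ s ∈ block N n a, (reward (S a) (h s).2 - armValue S ν a)

theorem blockMean_sub_armValue (hN : 0 < N) (hn : K * N ≤ n) (h : Traj K d n) (a : Fin K) :
    blockMean S N h a - armValue S ν a = deviation S ν N a h / N := by
  have hN' : (N : ℝ) ≠ 0 := by positivity
  rw [deviation, Finset.sum_sub_distrib, Finset.sum_const, card_block hN a.2 hn, nsmul_eq_mul,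
    sub_div, mul_div_cancel_left₀ _ hN', blockMean, block, Finset.sum_filter]

theorem hasSubgaussianMGF_deviation (hN : 0 < N) (hn : K * N ≤ n) (a : Fin K) :
    HasSubgaussianMGF (deviation S ν N a) (N * (d / 2) ^ 2) (trajLaw S π ν n) := by
  have hsub : HasSubgaussianMGF (fun w : RewardVec d => reward (S a) w - armValue S ν a)
      ((d / 2) ^ 2) (ν : Measure (RewardVec d)) := by
    have h1 := hasSubgaussianMGF_of_mem_Icc (μ := (ν : Measure (RewardVec d)))
      (X := reward (S a)) (a := 0) (b := d) (measurable_reward _).aemeasurable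
      (.of_forall fun w => ⟨reward_nonneg _ w, reward_le _ w⟩)
    rw [← armValue_eq_integral, sub_zero, Real.nnnorm_natCast] at h1
    exact h1
  have hpi := hasSubgaussianMGF_sum_pi ((measurable_reward (S a)).sub_const _) hsub (block N n a)
  rw [← map_trajLaw_rewards S π ν n, card_block hN a.2 hn] at hpi
  have hmeas : AEMeasurable (fun (h : Traj K d n) (t : Fin n) => (h t).2) (trajLaw S π ν n) :=
    (measurable_pi_lambda _ fun t =>
      measurable_snd.comp (measurable_pi_apply t) : Measurable _).aemeasurable
  exact HasSubgaussianMGF.of_map (Y := fun (h : Traj K d n) t => (h t).2) hmeas hpi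

theorem integrable_deviation (hN : 0 < N) (hn : K * N ≤ n) (a : Fin K) :
    Integrable (deviation S ν N a) (trajLaw S π ν n) :=
  (hasSubgaussianMGF_deviation S π ν hN hn a).integrable

theorem coe_mul_div_two_sq : ((N * (d / 2) ^ 2 : NNReal) : ℝ) = N * (d / 2) ^ 2 := by
  push_cast
  rfl

theorem integral_abs_deviation_le (hN : 0 < N) (hd : 0 < d) (hn : K * N ≤ n) (a : Fin K) :
    ∫ h, |deviation S ν N a h| ∂trajLaw S π ν n ≤ 6 * (d * √N) := by
  set Z : Traj K d n → ℝ := deviation S ν N a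
  have hZ := hasSubgaussianMGF_deviation S π ν hN hn a
  have hsN : 0 < √(N : ℝ) := Real.sqrt_pos.2 (by exact_mod_cast hN)
  have hpos : 0 < d * √(N : ℝ) := by positivity
  -- With `l` the inverse of the scale of `Z`, both exponential moments are of constant order.
  set l : ℝ := (d * √(N : ℝ))⁻¹ with hl
  have hl0 : 0 < l := inv_pos.2 hpos
  have hc : ((N * (d / 2) ^ 2 : NNReal) : ℝ) * l ^ 2 / 2 = 1 / 8 := by
    have h1 : √(N : ℝ) ^ 2 = N := Real.sq_sqrt (Nat.cast_nonneg N)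
    have h2 : (N : ℝ) ≠ 0 := by positivity
    rw [coe_mul_div_two_sq, hl, inv_pow, mul_pow, h1]
    field_simp
    norm_num
  have h8 : Real.exp (1 / 8) ≤ 3 :=
    (Real.exp_le_exp.2 (by norm_num)).trans (Real.exp_one_lt_d9.le.trans (by norm_num))
  have h1 := hZ.mgf_le l
  have h2 := hZ.mgf_le (-l)
  rw [hc] at h1
  rw [neg_sq, hc] at h2
  have hi1 := hZ.integrable_exp_mul l
  have hi2 := hZ.integrable_exp_mul (-l)
  have h3 : l * ∫ h, |Z h| ∂trajLaw S π ν n ≤ 6 := by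
    calc l * ∫ h, |Z h| ∂trajLaw S π ν n
        = ∫ h, l * |Z h| ∂trajLaw S π ν n := (integral_const_mul _ _).symm
      _ ≤ ∫ h, (Real.exp (l * Z h) + Real.exp (-l * Z h)) ∂trajLaw S π ν n := by
          refine integral_mono (hZ.integrable.abs.const_mul l) (hi1.add hi2) fun h => ?_
          have e1 := Real.add_one_le_exp (l * Z h)
          have e2 := Real.add_one_le_exp (-l * Z h)
          have e3 := Real.exp_pos (l * Z h)
          have e4 := Real.exp_pos (-l * Z h)
          rcases abs_cases (Z h) with ⟨h, _⟩ | ⟨h, _⟩ <;> simp only [h] <;> linarith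
      _ ≤ 3 + 3 := by
          rw [integral_add hi1 hi2]
          exact add_le_add (h1.trans h8) (h2.trans h8)
      _ = 6 := by norm_num
  calc _ = (d * √N) * (l * ∫ h, |Z h| ∂trajLaw S π ν n) := by
        rw [hl, mul_inv_cancel_left₀ hpos.ne']
    _ ≤ (d * √N) * 6 := by gcongr
    _ = _ := mul_comm _ _

/-- Hoeffding's inequality for all blocks at once. -/
theorem measureReal_exists_deviation_le {δ : ℝ} (hδ : 0 < δ) (hN : 0 < N) (hd : 0 < d)
    (hn : K * N ≤ n) :
    (trajLaw S π ν n).real {h | ∃ a, N * (δ / 2) ≤ |deviation S ν N a h|} ≤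
      K * (2 * Real.exp (-(N * δ ^ 2 / (2 * d ^ 2)))) := by
  have hN' : (N : ℝ) ≠ 0 := by positivity
  have hd' : (d : ℝ) ≠ 0 := by positivity
  have hexp : -(N * (δ / 2)) ^ 2 / (2 * ((N * (d / 2) ^ 2 : NNReal) : ℝ)) =
      -(N * δ ^ 2 / (2 * d ^ 2)) := by
    rw [coe_mul_div_two_sq]
    field_simp
  have hone : ∀ a, (trajLaw S π ν n).real {h | N * (δ / 2) ≤ |deviation S ν N a h|} ≤
      2 * Real.exp (-(N * δ ^ 2 / (2 * d ^ 2))) := by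
    intro a
    have hZ := hasSubgaussianMGF_deviation S π ν hN hn a
    have h1 := hZ.measure_ge_le (ε := N * (δ / 2)) (by positivity)
    have h2 := hZ.neg.measure_ge_le (ε := N * (δ / 2)) (by positivity)
    rw [hexp] at h1 h2
    calc (trajLaw S π ν n).real {h | N * (δ / 2) ≤ |deviation S ν N a h|}
        ≤ (trajLaw S π ν n).real ({h | N * (δ / 2) ≤ deviation S ν N a h} ∪
          {h | N * (δ / 2) ≤ (-deviation S ν N a) h}) :=
          measureReal_mono fun h (hh : N * (δ / 2) ≤ |deviation S ν N a h|) => le_abs.1 hh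
      _ ≤ _ := measureReal_union_le _ _
      _ ≤ Real.exp (-(N * δ ^ 2 / (2 * d ^ 2))) + Real.exp (-(N * δ ^ 2 / (2 * d ^ 2))) :=
          add_le_add h1 h2
      _ = _ := (two_mul _).symm
  have hU : {h : Traj K d n | ∃ a, N * (δ / 2) ≤ |deviation S ν N a h|} =
      ⋃ a, {h | N * (δ / 2) ≤ |deviation S ν N a h|} := by
    ext h
    simp
  rw [hU]
  calc _ ≤ ∑ a, (trajLaw S π ν n).real {h | N * (δ / 2) ≤ |deviation S ν N a h|} :=
        measureReal_iUnion_fintype_le _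
    _ ≤ ∑ _a : Fin K, 2 * Real.exp (-(N * δ ^ 2 / (2 * d ^ 2))) :=
        Finset.sum_le_sum fun a _ => hone a
    _ = _ := by simp

end Concentration

/-! ### Regret and error of explore-then-commit -/

section ETC

variable {fb : Feedback} {K d : ℕ} {S : Fin K → Finset (Fin d)}
  {ν : ProbabilityMeasure (RewardVec d)} {N n : ℕ} [Nonempty (Fin K)]

/-- If all block means are within `δ / 2` of the true values, the gap `δ` makes the committed arm
optimal. -/
theorem armValue_argmax_eq {δ : ℝ} (hν : ν ∈ instances S δ) (hN : 0 < N) (hn : K * N ≤ n)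
    {h : Traj K d n} (hh : ∀ a, |deviation S ν N a h| < N * (δ / 2)) :
    armValue S ν (argmax (blockMean S N h)) = optValue S ν := by
  have hN' : (0 : ℝ) < N := by exact_mod_cast hN
  have hclose : ∀ a, |blockMean S N h a - armValue S ν a| < δ / 2 := fun a => by
    rw [blockMean_sub_armValue S ν hN hn, abs_div, Nat.abs_cast, div_lt_iff₀' hN']
    exact hh a
  obtain ⟨o, ho⟩ := exists_eq_ciSup_of_finite (f := armValue S ν)
  change armValue S ν o = optValue S ν at ho
  rcases hν (argmax (blockMean S N h)) with h1 | h1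
  · exact h1
  · have h2 := le_argmax (blockMean S N h) o
    have h3 := (abs_lt.1 (hclose o)).1
    have h4 := (abs_lt.1 (hclose (argmax (blockMean S N h)))).2
    linarith

/-- The regret of explore-then-commit: the exploration rounds, and the rounds after committing to
a wrong arm. -/
theorem regret_etcPolicy_le {δ : ℝ} (hδ : 0 < δ) (hν : ν ∈ instances S δ) (hN : 0 < N)
    (hd : 0 < d) (hn : K * N ≤ n) :
    regret S (etcPolicy fb K d N) ν n ≤
      d * (K * N) + n * (d * (K * (2 * Real.exp (-(N * δ ^ 2 / (2 * d ^ 2)))))) := by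
  set μ := trajLaw S (etcPolicy fb K d N) ν n
  set A : Set (Traj K d n) := {h | ∃ a, N * (δ / 2) ≤ |deviation S ν N a h|} with hA
  have hAm : NullMeasurableSet A μ := by
    have hU : A = ⋃ a, {h | N * (δ / 2) ≤ |deviation S ν N a h|} := by
      ext h
      simp [hA]
    rw [hU]
    refine NullMeasurableSet.iUnion fun a => nullMeasurableSet_le aemeasurable_const ?_
    exact (integrable_deviation S _ ν hN hn a).abs.aestronglyMeasurable.aemeasurable
  have hround : ∀ t : Fin n, ∫ h, (optValue S ν - armValue S ν (h t).1) ∂μ ≤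
      (if (t : ℕ) / N < K then (d : ℝ) else 0) + d * μ.real A := by
    intro t
    have hint : Integrable (A.indicator fun _ => (d : ℝ)) μ :=
      (integrable_const _).indicator₀ hAm
    calc _ ≤ ∫ h, ((if (t : ℕ) / N < K then (d : ℝ) else 0) + A.indicator (fun _ => (d : ℝ)) h)
          ∂μ := by
          refine integral_mono_ae (integrable_arm S _ ν n t fun a => optValue S ν - armValue S ν a)
            ((integrable_const _).add hint) ?_
          filter_upwards [ae_etcPolicy (fb := fb) S ν N n] with h hh
          have h1 := optValue_le S ν
          have h2 := armValue_nonneg S ν (h t).1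
          have h3 : 0 ≤ A.indicator (fun _ => (d : ℝ)) h :=
            Set.indicator_nonneg (fun _ _ => Nat.cast_nonneg d) h
          by_cases ht : (t : ℕ) / N < K
          · simp only [ht, if_true]
            linarith
          · simp only [ht, if_false, zero_add]
            by_cases hhA : h ∈ A
            · rw [Set.indicator_of_mem hhA]
              linarith
            · rw [hh t, dif_neg ht, armValue_argmax_eq hν hN hn, sub_self]
              · exact h3
              · simpa [hA] using hhA
      _ = _ := by
          rw [integral_add (integrable_const _) hint, integral_indicator₀ hAm]
          simp [mul_comm, μ]
  have hcard : (Finset.univ.filter fun t : Fin n => (t : ℕ) / N < K).card ≤ K * N := by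
    rw [← Finset.card_map Fin.valEmbedding]
    calc _ ≤ (Finset.range (K * N)).card := by
          refine Finset.card_le_card fun s hs => ?_
          simp only [Finset.mem_map, Finset.mem_filter, Finset.mem_univ, true_and,
            Fin.valEmbedding_apply] at hs
          obtain ⟨t, ht, rfl⟩ := hs
          exact Finset.mem_range.2 ((Nat.div_lt_iff_lt_mul hN).1 ht)
      _ = K * N := Finset.card_range _
  have hcard' : ((Finset.univ.filter fun t : Fin n => (t : ℕ) / N < K).card : ℝ) ≤ K * N := by
    exact_mod_cast hcard
  rw [regret_eq]
  calc _ ≤ ∑ t : Fin n, ((if (t : ℕ) / N < K then (d : ℝ) else 0) + d * μ.real A) :=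
        Finset.sum_le_sum fun t _ => hround t
    _ = (Finset.univ.filter fun t : Fin n => (t : ℕ) / N < K).card * (d : ℝ) +
          n * (d * μ.real A) := by
        rw [Finset.sum_add_distrib, ← Finset.sum_filter]
        simp
    _ ≤ _ := by
        have := measureReal_exists_deviation_le S (etcPolicy fb K d N) ν hδ hN hd hn
        rw [mul_comm (d : ℝ) (K * N)]
        gcongr

theorem gapError_etc_le (P : DesignPair fb K d) (hpol : P.policy n = etcPolicy fb K d N)
    (hest : ∀ i j y, P.est n i j y = empMean fb N y i - empMean fb N y j)
    (hN : 0 < N) (hd : 0 < d) (hn : K * N ≤ n) (i j : Fin K) :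
    Integrable (fun h => P.est n i j (observed fb S n h)) (P.law S ν n) ∧
      P.gapError S ν n i j ≤ 12 * d / √N := by
  set μ := trajLaw S (etcPolicy fb K d N) ν n
  have hμ : P.law S ν n = μ := by rw [DesignPair.law, hpol]
  have hN' : (0 : ℝ) < N := by exact_mod_cast hN
  have hint : ∀ a, Integrable (deviation S ν N a) μ :=
    fun a => integrable_deviation S _ ν hN hn a
  have hae : ∀ᵐ h ∂μ, P.est n i j (observed fb S n h) =
      armGap S ν i j + (deviation S ν N i h / N - deviation S ν N j h / N) := by
    filter_upwards [ae_etcPolicy (fb := fb) S ν N n] with h hh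
    rw [hest, empMean_observed S fun s hs => by rw [hh s, dif_pos hs],
      ← blockMean_sub_armValue S ν hN hn, ← blockMean_sub_armValue S ν hN hn, armGap]
    ring
  have hdiff : Integrable (fun h => deviation S ν N i h / N - deviation S ν N j h / N) μ :=
    ((hint i).div_const _).sub ((hint j).div_const _)
  refine ⟨?_, ?_⟩
  · rw [hμ]
    exact ((integrable_const (armGap S ν i j)).add hdiff).congr (hae.mono fun _ hh => hh.symm)
  · rw [DesignPair.gapError, hμ]
    calc _ = ∫ h, |deviation S ν N i h / N - deviation S ν N j h / N| ∂μ := by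
          refine integral_congr_ae (hae.mono fun h hh => ?_)
          simp only [hh]
          rw [sub_add_cancel_left, abs_neg]
      _ ≤ ∫ h, (|deviation S ν N i h| / N + |deviation S ν N j h| / N) ∂μ := by
          refine integral_mono hdiff.abs
            (((hint i).abs.div_const _).add ((hint j).abs.div_const _)) fun h => ?_
          refine (abs_sub _ _).trans (le_of_eq ?_)
          simp only [abs_div, Nat.abs_cast]
      _ ≤ 6 * (d * √N) / N + 6 * (d * √N) / N := by
          rw [integral_add ((hint i).abs.div_const _) ((hint j).abs.div_const _), integral_div,
            integral_div]
          have h1 := integral_abs_deviation_le S (etcPolicy fb K d N) ν hN hd hn i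
          have h2 := integral_abs_deviation_le S (etcPolicy fb K d N) ν hN hd hn j
          gcongr
      _ = 12 * d / √N := by
          have hs : 0 < √(N : ℝ) := Real.sqrt_pos.2 hN'
          have h1 : (N : ℝ) = √N * √N := (Real.mul_self_sqrt hN'.le).symm
          rw [← add_div, div_eq_div_iff hN'.ne' hs.ne']
          linear_combination -12 * (d : ℝ) * h1

end ETC

section Tuning

variable {fb : Feedback} {K d : ℕ} {S : Fin K → Finset (Fin d)} [Nonempty (Fin K)]

/-- Explore-then-commit reaches every trade-off between a regret `x` of more than logarithmic size
and an error `1 / √x`. -/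
theorem etc_tradeoff {δ : ℝ} (hδ : 0 < δ) (hd : 0 < d) {n : ℕ} (hn : 0 < n) {x : ℝ}
    (hxn : x ≤ n * d)
    (hx : (2 * (d * K) + 4 * d ^ 3 * K / δ ^ 2) * (1 + Real.log n) ≤ x)
    {P : DesignPair fb K d} (hpol : P.policy n = etcPolicy fb K d ⌊x / (d * K)⌋₊)
    (hest : ∀ i j y, P.est n i j y =
      empMean fb ⌊x / (d * K)⌋₊ y i - empMean fb ⌊x / (d * K)⌋₊ y j)
    {ν : ProbabilityMeasure (RewardVec d)} (hν : ν ∈ instances S δ) :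
    P.regret S ν n ≤ 2 * x ∧ ∀ i j,
      Integrable (fun h => P.est n i j (observed fb S n h)) (P.law S ν n) ∧
        P.gapError S ν n i j ≤ 12 * d * √(2 * (d * K)) / √x ∧ P.gapError S ν n i j ≤ 12 * d := by
  set N := ⌊x / (d * K)⌋₊
  have hK : 0 < K := Fin.pos_iff_nonempty.2 inferInstance
  have hd' : (0 : ℝ) < d := by exact_mod_cast hd
  have hK' : (0 : ℝ) < K := by exact_mod_cast hK
  have hn' : (0 : ℝ) < n := by exact_mod_cast hn
  have hdK : (0 : ℝ) < d * K := by positivity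
  have hlog : 0 ≤ Real.log n := Real.log_natCast_nonneg n
  have hx2 : 2 * (d * K) ≤ x := by
    refine le_trans ?_ hx
    have : (0 : ℝ) ≤ 4 * d ^ 3 * K / δ ^ 2 := by positivity
    nlinarith
  have hx0 : 0 < x := by linarith
  have hy2 : 2 ≤ x / (d * K) := by rwa [le_div_iff₀ hdK]
  have hNle : (N : ℝ) ≤ x / (d * K) := Nat.floor_le (by positivity)
  have hNge : x / (2 * (d * K)) ≤ N := by
    have h1 := Nat.lt_floor_add_one (x / (d * K))
    have h2 : x / (2 * (d * K)) = x / (d * K) / 2 := by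
      rw [div_div]
      ring
    rw [h2]
    linarith
  have hN1 : (1 : ℝ) ≤ N := by
    refine le_trans ?_ hNge
    rw [le_div_iff₀ (by positivity)]
    linarith
  have hN : 0 < N := by exact_mod_cast zero_lt_one.trans_le hN1
  have hdKN : d * (K * N) ≤ x := by
    rw [le_div_iff₀ hdK] at hNle
    linarith
  have hKN : K * N ≤ n := by
    have : (K : ℝ) * N ≤ n := by
      refine le_of_mul_le_mul_left ?_ hd'
      linarith
    exact_mod_cast this
  refine ⟨?_, fun i j => ?_⟩
  · have h1 := regret_etcPolicy_le (fb := fb) hδ hν hN hd hKN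
    have hexp : n * Real.exp (-(N * δ ^ 2 / (2 * d ^ 2))) ≤ 1 := by
      have h2 : Real.log n ≤ N * δ ^ 2 / (2 * d ^ 2) := by
        have h3 : 4 * d ^ 3 * K / δ ^ 2 * Real.log n ≤ x := by
          refine le_trans ?_ hx
          have : (0 : ℝ) ≤ 4 * d ^ 3 * K / δ ^ 2 := by positivity
          nlinarith
        calc Real.log n = 4 * d ^ 3 * K / δ ^ 2 * Real.log n / (2 * (d * K)) * δ ^ 2 /
              (2 * d ^ 2) := by field_simp; norm_num
          _ ≤ x / (2 * (d * K)) * δ ^ 2 / (2 * d ^ 2) := by gcongr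
          _ ≤ _ := by gcongr
      calc n * Real.exp (-(N * δ ^ 2 / (2 * d ^ 2))) ≤ n * Real.exp (-Real.log n) := by gcongr
        _ = 1 := by rw [Real.exp_neg, Real.exp_log hn', mul_inv_cancel₀ hn'.ne']
    rw [DesignPair.regret, hpol]
    calc _ ≤ _ := h1
      _ = d * (K * N) + 2 * (d * K) * (n * Real.exp (-(N * δ ^ 2 / (2 * d ^ 2)))) := by ring
      _ ≤ x + 2 * (d * K) * 1 := by gcongr
      _ ≤ 2 * x := by linarith
  · obtain ⟨h1, h2⟩ := gapError_etc_le (S := S) (ν := ν) P hpol hest hN hd hKN i j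
    refine ⟨h1, h2.trans ?_, h2.trans ?_⟩
    · have h3 : √x / √(2 * (d * K)) ≤ √(N : ℝ) := by
        rw [← Real.sqrt_div hx0.le]
        exact Real.sqrt_le_sqrt hNge
      have h4 : 0 < √x := Real.sqrt_pos.2 hx0
      have h5 : 0 < √(2 * ((d : ℝ) * K)) := Real.sqrt_pos.2 (by positivity)
      calc 12 * d / √(N : ℝ) ≤ 12 * d / (√x / √(2 * (d * K))) := by gcongr
        _ = _ := by rw [div_div_eq_mul_div]
    · exact div_le_self (by positivity) (Real.one_le_sqrt.2 hN1)

end Tuning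

/-! ### Pareto optimality -/

theorem eventually_one_le_log : ∀ᶠ n : ℕ in atTop, 1 ≤ Real.log n :=
  (Real.tendsto_log_atTop.comp tendsto_natCast_atTop_atTop).eventually_ge_atTop 1

theorem sqrt_le_one_add {x : ℝ} (hx : 0 ≤ x) : √x ≤ 1 + x :=
  Real.sqrt_le_left (by linarith) |>.2 (by nlinarith)

theorem LogLE.exists_abs {f g : ℕ → ℝ} (h : LogLE f g) (hg : ∀ n, 0 ≤ g n) :
    ∃ (C : ℝ) (a : ℕ), 0 ≤ C ∧ ∀ᶠ n : ℕ in atTop, f n ≤ C * Real.log n ^ a * g n := by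
  obtain ⟨C, a, h⟩ := h
  refine ⟨|C|, a, abs_nonneg C, h.mono fun n hn => hn.trans ?_⟩
  have := hg n
  have := Real.log_natCast_nonneg n
  gcongr
  exact le_abs_self C

section Main

variable {fb : Feedback} {K d m : ℕ} {S : Fin K → Finset (Fin d)} {δ : ℝ}

theorem armValue_eq_optValue (hK : K ≤ 1) (ν : ProbabilityMeasure (RewardVec d)) (i : Fin K) :
    armValue S ν i = optValue S ν := by
  have : Subsingleton (Fin K) := Fin.subsingleton_iff_le_one.2 hK
  exact (optValue_eq_of_forall_le S ν fun k => by rw [Subsingleton.elim k]).symm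

theorem mem_instances_of_le_one (hK : K ≤ 1) (δ : ℝ) (ν : ProbabilityMeasure (RewardVec d)) :
    ν ∈ instances S δ := fun i => .inl (armValue_eq_optValue hK ν i)

theorem regret_eq_zero (hK : K ≤ 1) (π : Policy fb K d) (ν : ProbabilityMeasure (RewardVec d))
    (n : ℕ) : regret S π ν n = 0 := by
  rw [regret_eq]
  simp [armValue_eq_optValue hK]

theorem maxError_eq_zero (hK : K ≤ 1) (P : DesignPair fb K d)
    (ν : ProbabilityMeasure (RewardVec d)) (n : ℕ) : P.maxError S ν n = 0 := by
  have : Subsingleton (Fin K) := Fin.subsingleton_iff_le_one.2 hK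
  have : IsEmpty {p : Fin K × Fin K // p.1 < p.2} :=
    ⟨fun p => p.2.ne (Subsingleton.elim _ _)⟩
  exact Real.iSup_of_isEmpty _

/-- If the product of error and `√regret` is `Õ(1)`, any dominating pair would have to violate the
lower bound, unless both comparisons are equalities up to polylogarithmic factors. -/
theorem isParetoOptimal_of_worstCase (hS : Function.Injective S) (hm : ∀ i, (S i).card = m)
    (hK : 2 ≤ K) (hδ : 0 < δ) (hδ' : δ < 1 / 2) {P : DesignPair fb K d}
    (hW : WorstCaseProductIsTildeOOne S (instances S δ) P) :
    IsParetoOptimal S (instances S δ) P := by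
  rintro ⟨P', hP', hdom⟩
  obtain ⟨c, hc, hlow⟩ := exists_le_maxError_mul_sqrt_regret hS hm hK hδ hδ' hP'
  have hex : ∀ n, ∃ ν ∈ instances S δ,
      1 ≤ n → c ≤ P'.maxError S ν n * √(P'.regret S ν n) := by
    intro n
    by_cases hn : 1 ≤ n
    · obtain ⟨ν, h1, h2⟩ := hlow n hn
      exact ⟨ν, h1, fun _ => h2⟩
    · obtain ⟨ν, h1, -⟩ := hlow 1 le_rfl
      exact ⟨ν, h1, fun h => absurd h hn⟩
  choose ν' hν' hprod using hex
  obtain ⟨ν, hν, hR, hE, hstrict⟩ := hdom ν' hν'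
  have hR0 : ∀ n, 0 ≤ P.regret S (ν n) n := fun n => regret_nonneg S _ _ n
  have hR0' : ∀ n, 0 ≤ P'.regret S (ν' n) n := fun n => regret_nonneg S _ _ n
  have hE0 : ∀ n, 0 ≤ P.maxError S (ν n) n := fun n => P.maxError_nonneg S _ n
  have hE0' : ∀ n, 0 ≤ P'.maxError S (ν' n) n := fun n => P'.maxError_nonneg S _ n
  obtain ⟨C₁, a₁, hC₁, h₁⟩ := hR.exists_abs hR0
  obtain ⟨C₂, a₂, hC₂, h₂⟩ := hE.exists_abs hE0
  obtain ⟨C₃, a₃, hC₃, h₃⟩ : ∃ (C : ℝ) (a : ℕ), 0 ≤ C ∧ ∀ᶠ n : ℕ in atTop,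
      P.maxError S (ν n) n * √(P.regret S (ν n) n) ≤ C * Real.log n ^ a * 1 := by
    obtain ⟨C, a, h⟩ := hW
    exact LogLE.exists_abs (g := fun _ => 1)
      ⟨C, a, h.mono fun n hn => by rw [mul_one]; exact hn _ (hν n)⟩ fun _ => zero_le_one
  simp only [mul_one] at h₃
  refine hstrict.elim (fun h => h ?_) (fun h => h ?_)
  · refine ⟨(C₂ * C₃ / c) ^ 2, 2 * a₂ + 2 * a₃, ?_⟩
    filter_upwards [h₂, h₃, eventually_ge_atTop 1] with n h₂ h₃ hn
    have hp := hprod n hn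
    have hl := Real.log_natCast_nonneg n
    set R := P.regret S (ν n) n
    set R' := P'.regret S (ν' n) n
    set E := P.maxError S (ν n) n
    set E' := P'.maxError S (ν' n) n
    set l := Real.log n
    have key : c ^ 2 * R ≤ (C₂ * l ^ a₂) ^ 2 * (C₃ * l ^ a₃) ^ 2 * R' := by
      calc c ^ 2 * R ≤ (E' * √R') ^ 2 * R := by
            have := hR0 n
            gcongr
        _ = E' ^ 2 * (R' * R) := by rw [mul_pow, Real.sq_sqrt (hR0' n)]; ring
        _ ≤ (C₂ * l ^ a₂ * E) ^ 2 * (R' * R) := by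
            have := mul_nonneg (hR0' n) (hR0 n)
            have := hE0' n
            gcongr
        _ = (C₂ * l ^ a₂) ^ 2 * (E * √R) ^ 2 * R' := by
            rw [mul_pow E, Real.sq_sqrt (hR0 n)]; ring
        _ ≤ _ := by
            have := hR0' n
            have := mul_nonneg (hE0 n) (Real.sqrt_nonneg R)
            gcongr
    calc R = (c ^ 2 * R) / c ^ 2 := by field_simp
      _ ≤ (C₂ * l ^ a₂) ^ 2 * (C₃ * l ^ a₃) ^ 2 * R' / c ^ 2 := by gcongr
      _ = _ := by ring
  · refine ⟨C₃ * (1 + C₁) / c, a₁ + a₃, ?_⟩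
    filter_upwards [h₁, h₃, eventually_ge_atTop 1, eventually_one_le_log] with n h₁ h₃ hn hl1
    have hp := hprod n hn
    have hl := Real.log_natCast_nonneg n
    set R := P.regret S (ν n) n
    set R' := P'.regret S (ν' n) n
    set E := P.maxError S (ν n) n
    set E' := P'.maxError S (ν' n) n
    set l := Real.log n
    have hA : 0 ≤ C₁ * l ^ a₁ := by positivity
    have hs : √(C₁ * l ^ a₁) ≤ (1 + C₁) * l ^ a₁ := by
      have := one_le_pow₀ hl1 (n := a₁)
      linarith [sqrt_le_one_add hA]
    have key : c * E ≤ C₃ * l ^ a₃ * ((1 + C₁) * l ^ a₁) * E' := by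
      have e0 := hE0 n
      have e1 := hE0' n
      calc c * E ≤ E' * √R' * E := by gcongr
        _ ≤ E' * √(C₁ * l ^ a₁ * R) * E := by gcongr
        _ = (E * √R) * √(C₁ * l ^ a₁) * E' := by rw [Real.sqrt_mul hA]; ring
        _ ≤ _ := by gcongr
    calc E = (c * E) / c := by field_simp
      _ ≤ C₃ * l ^ a₃ * ((1 + C₁) * l ^ a₁) * E' / c := by gcongr
      _ = _ := by ring

/-- Outside the horizons in `s`, the pair is `P`; at the horizons in `s`, it is explore-then-commit
with blocks of length `N n`. -/
theorem exists_modified_pair [Nonempty (Fin K)] (P : DesignPair fb K d) (s : Set ℕ) (N : ℕ → ℕ) :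
    ∃ P' : DesignPair fb K d,
      (∀ n ∈ s, P'.policy n = etcPolicy fb K d (N n) ∧
        ∀ i j y, P'.est n i j y = empMean fb (N n) y i - empMean fb (N n) y j) ∧
      ∀ n ∉ s, P'.policy n = P.policy n ∧ P'.est n = P.est n := by
  classical
  refine ⟨⟨fun n => if n ∈ s then etcPolicy fb K d (N n) else P.policy n,
    fun n => if n ∈ s then fun i j y => empMean fb (N n) y i - empMean fb (N n) y j
      else P.est n, fun n i j => ?_⟩, fun n hn => ?_, fun n hn => ?_⟩
  · by_cases hn : n ∈ s
    · simp only [hn, if_true]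
      have h := measurable_empMean fb (K := K) (d := d) (N n) n
      exact ((measurable_pi_apply i).comp h).sub ((measurable_pi_apply j).comp h)
    · simp only [hn, if_false]
      exact P.measurable_est n i j
  · simp [hn]
  · simp [hn]

/-- If the product of error and `√regret` exceeds every power of the logarithm infinitely often,
explore-then-commit with the regret of a worst instance improves on the error there. -/
theorem worstCase_of_isParetoOptimal (hS : Function.Injective S) (hm : ∀ i, (S i).card = m)
    (hK : 2 ≤ K) (hδ : 0 < δ) (hδ' : δ < 1 / 2) {P : DesignPair fb K d}
    (hP : P.IsAdmissible S (instances S δ)) (hopt : IsParetoOptimal S (instances S δ) P) :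
    WorstCaseProductIsTildeOOne S (instances S δ) P := by
  have hne : Nonempty (Fin K) := ⟨⟨0, by omega⟩⟩
  obtain ⟨B₀, hB₀⟩ := hP
  set B := max B₀ 1
  have hB1 : 1 ≤ B := le_max_right _ _
  have hB : ∀ n, ∀ ν ∈ instances S δ, P.maxError S ν n ≤ B := fun n ν hν =>
    P.maxError_le S ν n (by linarith) fun i j hij =>
      (hB₀ n ν hν i j hij).2.trans (le_max_left _ _)
  have hd : 0 < d := by
    obtain ⟨e, -⟩ := Finset.card_pos.1 (one_le_card_sdiff (i := ⟨0, by omega⟩)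
      (j := ⟨1, by omega⟩) hS hm (by simp))
    exact Fin.pos e
  have hd' : (0 : ℝ) < d := by exact_mod_cast hd
  have hV : (instances S δ).Nonempty :=
    ⟨_, hardLaw_mem_instances_of_le (i := ⟨0, by omega⟩) (j := ⟨1, by omega⟩) hS hm hδ
      (p := 0) (by simp only [Set.Icc.coe_zero]; linarith)⟩
  have hworst : ∀ n, ∃ ν ∈ instances S δ, ∀ ν' ∈ instances S δ,
      P.maxError S ν' n * √(P.regret S ν' n) ≤
        2 * (P.maxError S ν n * √(P.regret S ν n)) := fun n =>
    exists_forall_le_two_mul hV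
      (fun ν _ => mul_nonneg (P.maxError_nonneg S ν n) (Real.sqrt_nonneg _))
      (B := B * √(n * d)) fun ν hν => mul_le_mul (hB n ν hν)
        (Real.sqrt_le_sqrt (regret_le S _ ν n)) (Real.sqrt_nonneg _) (by linarith)
  choose ω hω hmax using hworst
  set x : ℕ → ℝ := fun n => P.regret S (ω n) n
  set e : ℕ → ℝ := fun n => P.maxError S (ω n) n
  have hx0 : ∀ n, 0 ≤ x n := fun n => regret_nonneg S _ _ n
  have he0 : ∀ n, 0 ≤ e n := fun n => P.maxError_nonneg S _ n
  -- The threshold makes the regret at the worst instance large enough for `etc_tradeoff`.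
  set Q : ℝ := 2 * (d * K) + 4 * d ^ 3 * K / δ ^ 2
  have hQ0 : 0 ≤ Q := by positivity
  set c₀ : ℝ := B * (1 + √Q) with hc₀
  have hsQ := Real.sqrt_nonneg Q
  have hc₀1 : 1 ≤ c₀ := by rw [hc₀]; nlinarith
  set s : Set ℕ := {n | 0 < n ∧ c₀ * (1 + Real.log n) ≤ e n * √(x n)}
  have hs1 : ∀ n ∈ s, 1 ≤ e n * √(x n) := fun n hn => by
    have := Real.log_natCast_nonneg n
    have := hn.2
    nlinarith
  have hsx : ∀ n ∈ s, Q * (1 + Real.log n) ≤ x n := fun n hn => by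
    have hl := Real.log_natCast_nonneg n
    have h1 : B * (1 + √Q) * (1 + Real.log n) ≤ B * √(x n) :=
      hn.2.trans (mul_le_mul_of_nonneg_right (hB n _ (hω n)) (Real.sqrt_nonneg _))
    rw [mul_assoc] at h1
    have h2 := le_of_mul_le_mul_left h1 (by linarith)
    have h3 := pow_le_pow_left₀ (by positivity) h2 2
    rw [Real.sq_sqrt (hx0 n)] at h3
    refine le_trans ?_ h3
    have h4 : Q = √Q ^ 2 := (Real.sq_sqrt hQ0).symm
    have h5 : Q ≤ (1 + √Q) ^ 2 := by nlinarith
    have h6 : 1 + Real.log n ≤ (1 + Real.log n) ^ 2 := by nlinarith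
    rw [mul_pow]
    gcongr
  obtain ⟨P', hin, hout⟩ := exists_modified_pair P s fun n => ⌊x n / (d * K)⌋₊
  set C : ℝ := 12 * d * √(2 * (d * K))
  have hC0 : 0 ≤ C := by positivity
  have hetc := fun n (hn : n ∈ s) (ν) (hν : ν ∈ instances S δ) =>
    etc_tradeoff hδ hd hn.1 (regret_le S _ _ n) (hsx n hn) (hin n hn).1 (hin n hn).2 hν
  have hE' : ∀ n ∈ s, ∀ ν ∈ instances S δ, P'.maxError S ν n ≤ C / √(x n) :=
    fun n hn ν hν => P'.maxError_le S ν n (by positivity) fun i j _ => ((hetc n hn ν hν).2 i j).2.1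
  have hout_law : ∀ n ∉ s, ∀ ν, P'.law S ν n = P.law S ν n := fun n hn ν => by
    rw [DesignPair.law, DesignPair.law, (hout n hn).1]
  have hout_gap : ∀ n ∉ s, ∀ ν, P'.gapError S ν n = P.gapError S ν n := fun n hn ν => by
    funext i j
    rw [DesignPair.gapError, DesignPair.gapError, hout_law n hn, (hout n hn).2]
  have hout_err : ∀ n ∉ s, ∀ ν, P'.maxError S ν n = P.maxError S ν n := fun n hn ν => by
    rw [DesignPair.maxError, DesignPair.maxError, hout_gap n hn]
  have hout_reg : ∀ n ∉ s, ∀ ν, P'.regret S ν n = P.regret S ν n := fun n hn ν => by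
    rw [DesignPair.regret, DesignPair.regret, (hout n hn).1]
  by_contra hW
  refine hopt ⟨P', ⟨max B₀ (12 * d), fun n ν hν i j hij => ?_⟩, fun ν' hν' => ?_⟩
  · by_cases hn : n ∈ s
    · have := (hetc n hn ν hν).2 i j
      exact ⟨this.1, this.2.2.trans (le_max_right _ _)⟩
    · rw [hout_law n hn, hout_gap n hn, (hout n hn).2]
      exact ⟨(hB₀ n ν hν i j hij).1, (hB₀ n ν hν i j hij).2.trans (le_max_left _ _)⟩
  · classical
    set ν : ℕ → ProbabilityMeasure (RewardVec d) := fun n => if n ∈ s then ω n else ν' n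
    have hνin : ∀ n ∈ s, ν n = ω n := fun n hn => if_pos hn
    have hνout : ∀ n ∉ s, ν n = ν' n := fun n hn => if_neg hn
    have hR0' : ∀ n, 0 ≤ P'.regret S (ν' n) n := fun n => regret_nonneg S _ _ n
    have hE0' : ∀ n, 0 ≤ P'.maxError S (ν' n) n := fun n => P'.maxError_nonneg S _ n
    refine ⟨ν, fun n => ?_, ⟨2, 0, .of_forall fun n => ?_⟩, ⟨C + 1, 0, .of_forall fun n => ?_⟩, ?_⟩
    · by_cases hn : n ∈ s
      · rw [hνin n hn]
        exact hω n
      · rw [hνout n hn]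
        exact hν' n
    · beta_reduce
      rw [pow_zero, mul_one]
      by_cases hn : n ∈ s
      · rw [hνin n hn]
        exact (hetc n hn _ (hν' n)).1
      · have := hR0' n
        rw [hνout n hn, ← hout_reg n hn]
        linarith
    · beta_reduce
      rw [pow_zero, mul_one]
      by_cases hn : n ∈ s
      · rw [hνin n hn]
        have h1 := hs1 n hn
        have hsx0 : 0 < √(x n) := by
          refine (Real.sqrt_nonneg _).lt_of_ne fun h => ?_
          rw [← h, mul_zero] at h1
          linarith
        calc P'.maxError S (ν' n) n ≤ C / √(x n) := hE' n hn _ (hν' n)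
          _ ≤ C * e n := by
              rw [div_le_iff₀ hsx0, mul_assoc]
              exact le_mul_of_one_le_right hC0 h1
          _ ≤ (C + 1) * e n := by
              have := he0 n
              nlinarith
      · have := hE0' n
        rw [hνout n hn, ← hout_err n hn]
        nlinarith
    · -- If neither comparison were strict, the product would be `Õ(1)`, first along `ω`, then
      -- uniformly, since `ω` is a sequence of near-maximisers.
      by_contra hstrict
      push Not at hstrict
      obtain ⟨C₁, a₁, hC₁, h₁⟩ := hstrict.1.exists_abs hR0'
      obtain ⟨C₂, a₂, hC₂, h₂⟩ := hstrict.2.exists_abs hE0'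
      refine hW ⟨2 * (C₂ * (1 + C₁) * (2 * C) + 2 * c₀), a₁ + a₂ + 1, ?_⟩
      filter_upwards [h₁, h₂, eventually_one_le_log, eventually_gt_atTop 0]
        with n h₁ h₂ hl hn0 μ hμ
      refine (hmax n μ hμ).trans ?_
      set l := Real.log n
      have hl0 : 0 ≤ l := by linarith
      have hA : 0 ≤ C₁ * l ^ a₁ := by positivity
      have hpow : ∀ {a b : ℕ}, a ≤ b → l ^ a ≤ l ^ b := fun h => pow_le_pow_right₀ hl h
      have hgoal : e n * √(x n) ≤
          (C₂ * (1 + C₁) * (2 * C) + 2 * c₀) * l ^ (a₁ + a₂ + 1) := by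
        by_cases hn : n ∈ s
        · rw [hνin n hn] at h₁ h₂
          have hprod : P'.maxError S (ν' n) n * √(P'.regret S (ν' n) n) ≤ 2 * C := by
            have h3 := (hetc n hn _ (hν' n)).1
            have h4 : √(2 * x n) ≤ 2 * √(x n) := by
              rw [Real.sqrt_mul (by norm_num)]
              have : √(2 : ℝ) ≤ 2 := Real.sqrt_le_left (by norm_num) |>.2 (by norm_num)
              gcongr
            calc _ ≤ C / √(x n) * (2 * √(x n)) :=
                  mul_le_mul (hE' n hn _ (hν' n)) ((Real.sqrt_le_sqrt h3).trans h4)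
                    (Real.sqrt_nonneg _) (by positivity)
              _ = 2 * C * (√(x n) / √(x n)) := by ring
              _ ≤ 2 * C * 1 := by
                  gcongr
                  exact div_self_le_one _
              _ = 2 * C := mul_one _
          have hsq : √(C₁ * l ^ a₁) ≤ (1 + C₁) * l ^ a₁ := by
            have := one_le_pow₀ hl (n := a₁)
            linarith [sqrt_le_one_add hA]
          have hEn := hE0' n
          calc e n * √(x n)
              ≤ C₂ * l ^ a₂ * P'.maxError S (ν' n) n *
                  √(C₁ * l ^ a₁ * P'.regret S (ν' n) n) :=
                mul_le_mul h₂ (Real.sqrt_le_sqrt h₁) (Real.sqrt_nonneg _) (by positivity)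
            _ = C₂ * l ^ a₂ * √(C₁ * l ^ a₁) *
                  (P'.maxError S (ν' n) n * √(P'.regret S (ν' n) n)) := by
                rw [Real.sqrt_mul hA]
                ring
            _ ≤ C₂ * l ^ a₂ * ((1 + C₁) * l ^ a₁) * (2 * C) := by gcongr
            _ = C₂ * (1 + C₁) * (2 * C) * l ^ (a₁ + a₂) := by ring
            _ ≤ C₂ * (1 + C₁) * (2 * C) * l ^ (a₁ + a₂ + 1) := by
                exact mul_le_mul_of_nonneg_left (hpow (by omega)) (by positivity)
            _ ≤ _ := by
                gcongr
                linarith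
        · have h3 : e n * √(x n) < c₀ * (1 + l) := by
            by_contra! h
            exact hn ⟨hn0, h⟩
          calc e n * √(x n) ≤ c₀ * (1 + l) := h3.le
            _ ≤ c₀ * (2 * l) := by gcongr; linarith
            _ = 2 * c₀ * l ^ 1 := by ring
            _ ≤ 2 * c₀ * l ^ (a₁ + a₂ + 1) := by
                exact mul_le_mul_of_nonneg_left (hpow (by omega)) (by positivity)
            _ ≤ _ := by
                gcongr
                have : 0 ≤ C₂ * (1 + C₁) * (2 * C) := by positivity
                linarith
      linarith

end Main

end CMAB

end

theorem mainTheorem2 (fb : CMAB.Feedback) (d K m : ℕ) (S : Fin K → Finset (Fin d))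
    (hS : Function.Injective S) (hm : ∀ i, (S i).card = m)
    (δ : ℝ) (hδ : 0 < δ) (hδ' : δ < 1 / 2)
    (P : CMAB.DesignPair fb K d) (hP : P.IsAdmissible S (CMAB.instances S δ)) :
    CMAB.IsParetoOptimal S (CMAB.instances S δ) P ↔
      CMAB.WorstCaseProductIsTildeOOne S (CMAB.instances S δ) P := by
  rcases le_or_gt K 1 with hK | hK
  · -- With at most one arm both objectives vanish identically.
    refine iff_of_true ?_ ⟨0, 0, .of_forall fun n ν _ => by simp [CMAB.maxError_eq_zero hK]⟩
    rintro ⟨P', -, hdom⟩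
    let ν₀ : ProbabilityMeasure (CMAB.RewardVec d) := ⟨Measure.dirac 0, inferInstance⟩
    obtain ⟨ν, -, -, -, h⟩ := hdom (fun _ => ν₀) fun _ => CMAB.mem_instances_of_le_one hK δ ν₀
    refine h.elim (fun h => h ⟨0, 0, .of_forall fun n => ?_⟩)
      (fun h => h ⟨0, 0, .of_forall fun n => ?_⟩)
    · simp [CMAB.DesignPair.regret, CMAB.regret_eq_zero hK]
    · simp [CMAB.maxError_eq_zero hK]
  · exact ⟨CMAB.worstCase_of_isParetoOptimal hS hm hK hδ hδ' hP,
      CMAB.isParetoOptimal_of_worstCase hS hm hK hδ hδ'⟩
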